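/- **Setting.** Let $n\ge 2$, $1\le k\le n$, $P\ge 0$, $d\ge 7$ be integers, $c\ge1$ an integer constant, and $m'=ck$. Choose a bipartite graph uniformly at random among those with $n$ left nodes, $m'$ right nodes and every left node of degree $d$; let $N(j)$ be the neighbourhood of the left node $j$. For every edge $(i,j)$ choose independently a phase $\theta_{ij}$ uniformly from the $2^{3\lceil\log_2 k\rceil}$ equally spaced points $\frac{\pi}{2}\,t\,2^{-3\lceil\log_2 k\rceil}$, $0\le t<2^{3\lceil\log_2 k\rceil}$, of $[0,\pi/2)$. The random matrix $A\in\mathbb C^{m\times n}$ has $m=2m'=2ck$ rows: each right node $i$ has an identification row and a verification row, whose entries in column $j\in\{1,\dots,n\}$ are $a^{(I)}_{ij}=e^{\iota j\pi/(2n)}$ and $a^{(V)}_{ij}=e^{\iota\theta_{ij}}$ if $i\in N(j)$, and $0$ otherwise. **Decoder SHO-FA.** It knows $A$ and is given $y=(y^{(I)},y^{(V)})\in\mathbb C^m$. It keeps residuals $\tilde y^{(I)},\tilde y^{(V)}$ (initially $y^{(I)},y^{(V)}$), an estimate $\hat x$ (initially $0$) and a set $L$ of right nodes. A right node $i$ passes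 the leaf test if $\tilde y^{(I)}_i\ne0$; the number $j=\frac{2n}{\pi}\,\angle\tilde y^{(I)}_i$, with the phase taken modulo $\pi$, is an integer in $\{1,\dots,n\}$ with $i\in N(j)$; and $v=\tilde y^{(I)}_i/a^{(I)}_{ij}$ satisfies $a^{(V)}_{ij}v=\tilde y^{(V)}_i$. Initially $L$ is the set of nodes that pass. Then, at most $k$ times and while $L\neq\emptyset$, the decoder picks some $i\in L$, removes it, sets $\hat x_j=v$ for the $j,v$ found by the test, subtracts $v\,a^{(I)}_{i'j}$ and $v\,a^{(V)}_{i'j}$ from the residuals at all $i'\in N(j)$, and retests the nodes $i'\in N(j)\setminus\{i\}$, adding them to or removing them from $L$. The rule for picking from $L$ may be any function of the iteration number and of $L$, fixed independently of $A$ (hence also any random rule independent of $A$, such as the uniform one). The decoder is run either in exact real arithmetic, or in fixed-point arithmetic with $s$ bits before and $s$ bits after the binary point and tolerance $\tau$: the input, the entries of $A$ and the result of every operation (for complex numbers, the real and the imaginary part) are rounded to the nearest multiple of $2^{-s}$ in $[-2^s,2^s]$, the phase quotient above is rounded to the nearest integer $j$, $v$ is replaced by its real part, and the tests "$=0$", "is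 an integer" and "is equal" are passed when the discrepancy is at most $\tau$. A step is one memory access, arithmetic operation (including modulus, phase and nearest integer) or comparison, and operations on the set $L$ count as constantly many steps; a step on registers of $w$ bits counts as $w$ bit operations, where $w=4s+4+\lceil\log_2n\rceil+\lceil\log_2m'\rceil$ (enough for one complex number and two node indices). **Finite-precision signals.** Put $p=\lceil\log_2 n\rceil+P$. For an integer $\kappa\ge0$ call $(x',e)$, with $x'\in\mathbb R^n$ and $e\in\mathbb Z$, a representation of $x\in\mathbb R^n$ if $x'$ is $k$-sparse (at most $k$ nonzero entries), $\|x-x'\|_1\le 2^{-(P+1)}\|x\|_1$, and $2^{e-\kappa p}\le|x'_j|\le 2^e$ whenever $x'_j\neq0$. **Theorem.** For every $d\ge7$ there is an integer $c\ge1$ such that for every $\kappa\ge0$ there are constants $K,T\in\mathbb N$ and $C>0$, depending only on $d,c,\kappa$, such that for all $n\ge2$, $1\le k\le n$, $P\ge0$ and every picking rule, with $s=Kp$, $\tau=2^{-Tp}$ and $m=2ck$ measurements: 1. For every $k$-sparse $x\in\mathbb R^n$, with probability at least $1-C/k$ over $A$, SHO-FA in exact arithmetic applied to $y=Ax$ returns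 $\hat x=x$. 2. For every $k$-sparse $x\in\mathbb R^n$ and every representation $(x',e)$ of $x$, with probability at least $1-C/k$ over $A$, the output $\hat x$ of SHO-FA in fixed-point arithmetic applied to $2^{-e}Ax'$ satisfies $\|x-2^e\hat x\|_1\le2^{-P}\|x\|_1$. If $\kappa\ge3$, every $k$-sparse $x\in\mathbb R^n$ has a representation. 3. For every $A$ of the ensemble and every input, SHO-FA takes at most $Ck$ steps, in exact and in fixed-point arithmetic. 4. For every $A$ of the ensemble and every input, SHO-FA in fixed-point arithmetic uses at most $Ck(\log_2n+P)$ bit operations. -/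

import Mathlib

namespace SHOFA

open Real

/-! ## The random measurement matrix -/

/-- The random choices behind the matrix: a `d`-left-regular bipartite graph with `n` left and `M`
right nodes (for every left node, the set of its `d` neighbours) and a `B`-bit number for every pair
of a right and a left node, which gives the phase of the verification entry of an edge. -/
abbrev Design (n M d B : ℕ) : Type :=
  (Fin n → {s : Finset (Fin M) // s.card = d}) × (Fin M → Fin n → Fin (2 ^ B))

variable {n M d B : ℕ}

/-- The neighbours on the right of the left node `j`. -/
def nbrs (ω : Design n M d B) (j : Fin n) : Finset (Fin M) := (ω.1 j).1

/-- Identification weight of the left node number `j + 1`: the unit complex number of phase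
`(j + 1) π / (2 n)`. -/
noncomputable def coefI (j : Fin n) : ℂ :=
  Complex.exp ((((j : ℕ) + 1 : ℝ) * π / (2 * n) : ℝ) * Complex.I)

/-- Verification weight of the edge between `j` (left) and `i` (right): a unit complex number, of
phase uniform on the `2 ^ B` equally spaced points of `[0, π / 2)`. -/
noncomputable def coefV (ω : Design n M d B) (i : Fin M) (j : Fin n) : ℂ :=
  Complex.exp ((((ω.2 i j : ℕ) : ℝ) / 2 ^ B * (π / 2) : ℝ) * Complex.I)

/-- The measurement matrix, with `2 M` rows: the right node `i` has the identification row `(i, 0)`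
and the verification row `(i, 1)`. -/
noncomputable def sensing (ω : Design n M d B) : Matrix (Fin M × Fin 2) (Fin n) ℂ :=
  fun r j => if r.1 ∈ nbrs ω j then (if r.2 = 0 then coefI j else coefV ω r.1 j) else 0

/-- The measurement vector `A x` of a real vector `x`. -/
noncomputable def measure (ω : Design n M d B) (x : Fin n → ℝ) : Fin M × Fin 2 → ℂ :=
  (sensing ω).mulVec (fun j => (x j : ℂ))

/-- Probability of an event under the uniform distribution on a finite type. -/
noncomputable def prob {Ω : Type} [Fintype Ω] (E : Set Ω) : ℝ :=
  (E.ncard : ℝ) / Fintype.card Ω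

/-! ## Signals -/

/-- `x` has at most `k` nonzero entries. -/
def Sparse (k : ℕ) (x : Fin n → ℝ) : Prop := {j | x j ≠ 0}.ncard ≤ k

/-- The `ℓ₁` norm. -/
noncomputable def l1 (x : Fin n → ℝ) : ℝ := ∑ j, |x j|

/-- `x'` is a `k`-sparse finite-precision representation of `x`: it is accurate to relative `ℓ₁`
error `2 ^ (-(P + 1))`, and with respect to the common binary exponent `e` its nonzero entries span
at most `R` binary orders of magnitude. -/
def Represents (k P R : ℕ) (e : ℤ) (x x' : Fin n → ℝ) : Prop :=
  Sparse k x' ∧ l1 (x - x') ≤ (2 : ℝ) ^ (-((P : ℤ) + 1)) * l1 x ∧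
    ∀ j, x' j ≠ 0 → (2 : ℝ) ^ (e - R) ≤ |x' j| ∧ |x' j| ≤ (2 : ℝ) ^ e

/-! ## Arithmetic and step counting -/

/-- An arithmetic on real registers: every result is passed through `rnd`, and two numbers are taken
to agree if they differ by at most `tol`. -/
structure Arith where
  rnd : ℝ → ℝ
  tol : ℝ

/-- Complex registers hold the real and the imaginary part. -/
def Arith.rndC (ar : Arith) (z : ℂ) : ℂ := ⟨ar.rnd z.re, ar.rnd z.im⟩

/-- Exact real arithmetic. -/
def exact : Arith := ⟨id, 0⟩

/-- Rounding to the fixed-point format with a sign, `s` bits before and `s` bits after the binary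
point, with saturation: the result is an integer multiple of `2 ^ (-s)` in `[-2 ^ s, 2 ^ s]`. -/
noncomputable def fix (s : ℕ) (r : ℝ) : ℝ :=
  max (-(2 ^ s)) (min (2 ^ s) ((round (r * 2 ^ s) : ℝ) / 2 ^ s))

/-- Fixed-point arithmetic with tolerance `2 ^ (-t)`. -/
noncomputable def fixedPoint (s t : ℕ) : Arith := ⟨fix s, (2 : ℝ) ^ (-(t : ℤ))⟩

/-- Length in bits of a register that can hold a complex number of the fixed-point format (two
components, each with a sign, `s` bits after the binary point, and `s + 1` bits before it),
together with the index of a node on the left and one on the right. -/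
def wordBits (s n M : ℕ) : ℕ := 2 * (2 * s + 2) + Nat.clog 2 n + Nat.clog 2 M

/-- A computation: its result and the number of atomic steps that it has taken. -/
structure Timed (α : Type) where
  val : α
  steps : ℕ

instance : Monad Timed where
  pure a := ⟨a, 0⟩
  bind a f := ⟨(f a.val).val, a.steps + (f a.val).steps⟩

/-- One atomic step: an access to a memory cell or a table, an arithmetic operation (including the
modulus and the phase of a complex number, and the nearest integer), or a comparison. -/
def step {α : Type} (a : α) : Timed α := ⟨a, 1⟩

/-- An insertion into, a deletion from or a choice from a set of right nodes; with the set kept as an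
array with back pointers it takes at most six memory accesses. -/
def setOp {α : Type} (a : α) : Timed α := ⟨a, 6⟩

/-! ## The decoder -/

/-- The memory of the decoder: the residual identification and verification vectors, the signal
estimate and the current list of leaf nodes. -/
structure Memory (n M : ℕ) where
  resI : Fin M → ℂ
  resV : Fin M → ℂ
  xhat : Fin n → ℝ
  leaf : Finset (Fin M)

/-- The left node with number `q`, for `1 ≤ q ≤ n`. -/
def toNode (n : ℕ) (q : ℤ) : Option (Fin n) :=
  if h : 1 ≤ q ∧ q ≤ n then some ⟨(q - 1).toNat, by omega⟩ else none

open Classical in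
/-- The test whether the right node `i` is a leaf, that is, whether exactly one left node that is not
yet decoded contributes to its residual. It reads the number `j` of a candidate off the phase of the
identification residual modulo `π` (the sign of the entry being unknown), checks that `j` is a
neighbour of `i`, forms the value `v` of the entry and compares `v` times the verification weight
with the verification residual. If all checks succeed it returns `j` and `v`. -/
noncomputable def leafTest (ar : Arith) (ω : Design n M d B) (μ : Memory n M) (i : Fin M) :
    Timed (Option (Fin n × ℝ)) := do
  let u ← step (μ.resI i)
  let w ← step (μ.resV i)
  let a ← step (ar.rnd ‖u‖)
  let zero ← step (decide (a ≤ ar.tol))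
  if zero then pure none else do
    let φ ← step (ar.rnd u.arg)
    let neg ← step (decide (φ < 0))
    let ψ ← step (if neg then ar.rnd (φ + ar.rnd π) else φ)
    let t ← step (ar.rnd (ψ * ar.rnd (2 * n / π)))
    let q ← step (round t)
    let δ ← step (ar.rnd |t - q|)
    let int ← step (decide (δ ≤ ar.tol))
    if int then do
      let jo ← step (toNode n q)
      match jo with
      | none => pure none
      | some j => do
        let edge ← step (decide (i ∈ nbrs ω j))
        if edge then do
          let aI ← step (ar.rndC (coefI j))
          let aV ← step (ar.rndC (coefV ω i j))
          let v ← step (ar.rndC (u / aI)).re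
          let g ← step (ar.rndC (aV * v))
          let h ← step (ar.rndC (g - w))
          let r ← step (ar.rnd ‖h‖)
          let ok ← step (decide (r ≤ ar.tol))
          if ok then pure (some (j, v)) else pure none
        else pure none
    else pure none

/-- Subtract the contribution of the entry `j` with value `v` from both residuals at `i`. -/
noncomputable def subtract (ar : Arith) (ω : Design n M d B) (j : Fin n) (v : ℝ) (μ : Memory n M)
    (i : Fin M) : Timed (Memory n M) := do
  let aI ← step (ar.rndC (coefI j))
  let aV ← step (ar.rndC (coefV ω i j))
  let u ← step (μ.resI i)
  let w ← step (μ.resV i)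
  let pI ← step (ar.rndC (aI * v))
  let pV ← step (ar.rndC (aV * v))
  let u' ← step (ar.rndC (u - pI))
  let w' ← step (ar.rndC (w - pV))
  let μ ← step { μ with resI := Function.update μ.resI i u' }
  step { μ with resV := Function.update μ.resV i w' }

/-- Update the status of the right node `i` in the list of leaf nodes. -/
noncomputable def refresh (ar : Arith) (ω : Design n M d B) (μ : Memory n M) (i : Fin M) :
    Timed (Memory n M) := do
  let r ← leafTest ar ω μ i
  match r with
  | none => setOp { μ with leaf := μ.leaf.erase i }
  | some _ => setOp { μ with leaf := insert i μ.leaf }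

/-- The neighbours of `j`, in increasing order. -/
def nbrList (ω : Design n M d B) (j : Fin n) : List (Fin M) :=
  (List.finRange M).filter (· ∈ nbrs ω j)

/-- The peeling iterations, at most as many as the first number, the next one being number `t`. In
each of them a node `i` is picked from the list of leaf nodes, its parent `j` is decoded, the
contribution of `j` is subtracted from the residuals at all neighbours of `j`, and the list is
updated. The decoder stops when the list is empty. -/
noncomputable def peel (ar : Arith) (ω : Design n M d B) (pick : ℕ → Finset (Fin M) → Fin M) :
    ℕ → ℕ → Memory n M → Timed (Memory n M)
  | 0, _, μ => pure μ
  | f + 1, t, μ => do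
    let empty ← step (decide (μ.leaf = ∅))
    if empty then pure μ else do
      let i ← setOp (pick t μ.leaf)
      let r ← leafTest ar ω μ i
      let μ ← setOp { μ with leaf := μ.leaf.erase i }
      match r with
      | none => peel ar ω pick f (t + 1) μ
      | some (j, v) => do
        let μ ← step { μ with xhat := Function.update μ.xhat j v }
        let μ ← (nbrList ω j).foldlM (subtract ar ω j v) μ
        let μ ← ((nbrList ω j).erase i).foldlM (refresh ar ω) μ
        peel ar ω pick f (t + 1) μ

/-- Read the measurements of the right node `i` into the residuals. -/
noncomputable def load (ar : Arith) (y : Fin M × Fin 2 → ℂ) (μ : Memory n M) (i : Fin M) :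
    Timed (Memory n M) := do
  let u ← step (ar.rndC (y (i, 0)))
  let w ← step (ar.rndC (y (i, 1)))
  let μ ← step { μ with resI := Function.update μ.resI i u }
  step { μ with resV := Function.update μ.resV i w }

/-- The decoder: from memory that is zero everywhere, read the measurements, make the initial list of
leaf nodes, perform at most `k` peeling iterations, and return the signal estimate. -/
noncomputable def decode (ar : Arith) (ω : Design n M d B) (pick : ℕ → Finset (Fin M) → Fin M)
    (k : ℕ) (y : Fin M × Fin 2 → ℂ) : Timed (Fin n → ℝ) := do
  let μ ← (List.finRange M).foldlM (load ar y) ⟨0, 0, 0, ∅⟩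
  let μ ← (List.finRange M).foldlM (refresh ar ω) μ
  let μ ← peel ar ω pick k 0 μ
  pure μ.xhat

end SHOFA

/-! Call a right node a leaf of a set `S` of left nodes if it has exactly one neighbour in `S`. If
every nonempty set of support entries has a leaf, a decoder that is told the leaves peels the whole
support. A set of `s` left nodes without a leaf has at most `d s / 2` neighbours; by a union bound
over sets this happens with probability at most `1 / k` once `d ≥ 3` and `c ≥ 6 d²`.

A decoded entry inherits the errors of the residual it was read from, so errors travel along
self-avoiding walks. The expected weighted number of walks from a left node is at most 2, so by
Markov's inequality there are more than `2 k²` walks with probability at most `1 / k`, and otherwise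
errors grow only polynomially.

The trajectory of the decoder that is told the leaves depends on the graph alone, so the phases are
independent of it: a right node with at least two undecoded neighbours passes the leaf test for a
fraction of at most `2^{-B} ≤ k^{-3}` of its phases. A union bound over the `k + 1` iterations and
the `c k` right nodes shows that the actual decoder makes the same moves. -/

namespace SHOFA

open Real
open scoped BigOperators

section Decoder

/-! ## Cost of the decoder -/

variable {n M d B : ℕ}

section Timed

variable {α β : Type}

theorem Timed.val_pure (a : α) : (pure a : Timed α).val = a := rfl

theorem Timed.val_bind (a : Timed α) (f : α → Timed β) : (a >>= f).val = (f a.val).val := rfl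

theorem Timed.val_step_bind (a : α) (f : α → Timed β) : (step a >>= f).val = (f a).val := rfl

theorem Timed.val_setOp_bind (a : α) (f : α → Timed β) : (setOp a >>= f).val = (f a).val := rfl

theorem Timed.val_ite (c : Prop) [Decidable c] (a b : Timed α) :
    (if c then a else b).val = if c then a.val else b.val := apply_ite _ _ _ _

theorem Timed.steps_bind_le {a : Timed α} {f : α → Timed β} {p q : ℕ} (ha : a.steps ≤ p)
    (hf : ∀ b, (f b).steps ≤ q) : (a >>= f).steps ≤ p + q :=
  Nat.add_le_add ha (hf a.val)

theorem Timed.steps_pure (a : α) : (pure a : Timed α).steps = 0 := rfl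

theorem Timed.steps_pure_le (a : α) (p : ℕ) : (pure a : Timed α).steps ≤ p := Nat.zero_le p

theorem Timed.steps_ite (c : Prop) [Decidable c] (a b : Timed α) :
    (if c then a else b).steps = if c then a.steps else b.steps := apply_ite _ _ _ _

theorem Timed.steps_step_bind (a : α) (f : α → Timed β) :
    (step a >>= f).steps = 1 + (f a).steps := rfl

theorem Timed.steps_foldlM_le {f : β → α → Timed β} {p : ℕ} (h : ∀ b a, (f b a).steps ≤ p)
    (l : List α) (b : β) : (l.foldlM f b).steps ≤ l.length * p := by
  induction l generalizing b with
  | nil => exact Nat.zero_le _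
  | cons a l ih =>
    rw [List.foldlM_cons, List.length_cons, Nat.succ_mul, Nat.add_comm]
    exact Timed.steps_bind_le (h b a) ih

end Timed

section Steps

variable (ar : Arith) (ω : Design n M d B)

theorem steps_leafTest_le (μ : Memory n M) (i : Fin M) : (leafTest ar ω μ i).steps ≤ 21 := by
  unfold leafTest
  simp only [Timed.steps_step_bind, Timed.steps_ite, Timed.steps_pure]
  generalize toNode n _ = jo
  rcases jo with _ | j
  · simp only [Timed.steps_pure]
    split_ifs <;> omega
  · simp only [Timed.steps_step_bind, Timed.steps_ite, Timed.steps_pure]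
    split_ifs <;> omega

theorem steps_refresh_le (μ : Memory n M) (i : Fin M) : (refresh ar ω μ i).steps ≤ 27 :=
  Timed.steps_bind_le (p := 21) (q := 6) (steps_leafTest_le ar ω μ i) fun r => by
    rcases r with _ | r <;> exact le_rfl

theorem mem_nbrList {j : Fin n} {i : Fin M} : i ∈ nbrList ω j ↔ i ∈ nbrs ω j := by
  simp [nbrList]

theorem nodup_nbrList (j : Fin n) : (nbrList ω j).Nodup :=
  (List.nodup_finRange M).filter _

theorem length_nbrList (j : Fin n) : (nbrList ω j).length = d := by
  have h : (nbrList ω j).toFinset = nbrs ω j := by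
    ext i
    rw [List.mem_toFinset, mem_nbrList]
  rw [← List.toFinset_card_of_nodup (nodup_nbrList ω j), h]
  exact (ω.1 j).2

theorem steps_foldlM_subtract_le (j : Fin n) (v : ℝ) (μ : Memory n M) :
    ((nbrList ω j).foldlM (subtract ar ω j v) μ).steps ≤ d * 10 := by
  simpa only [length_nbrList] using
    Timed.steps_foldlM_le (f := subtract ar ω j v) (p := 10) (fun _ _ => le_rfl) (nbrList ω j) μ

theorem steps_foldlM_refresh_le (j : Fin n) (i : Fin M) (μ : Memory n M) :
    (((nbrList ω j).erase i).foldlM (refresh ar ω) μ).steps ≤ d * 27 := by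
  have hlen : ((nbrList ω j).erase i).length ≤ d :=
    List.length_erase_le.trans_eq (length_nbrList ω j)
  exact (Timed.steps_foldlM_le (steps_refresh_le ar ω) _ μ).trans (Nat.mul_le_mul_right 27 hlen)

variable (pick : ℕ → Finset (Fin M) → Fin M)

theorem steps_peel_le (f t : ℕ) (μ : Memory n M) :
    (peel ar ω pick f t μ).steps ≤ f * (35 + 37 * d) := by
  induction f generalizing t μ with
  | zero => exact Timed.steps_pure_le μ _
  | succ f ih =>
    have cost : (f + 1) * (35 + 37 * d)
        = 1 + (6 + (21 + (6 + (1 + (d * 10 + (d * 27 + f * (35 + 37 * d))))))) := by ring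
    rw [cost]
    refine Timed.steps_bind_le (p := 1) le_rfl fun empty => ?_
    split_ifs
    · exact Timed.steps_pure_le μ _
    refine Timed.steps_bind_le (p := 6) le_rfl fun i => ?_
    refine Timed.steps_bind_le (steps_leafTest_le ar ω μ i) fun r => ?_
    refine Timed.steps_bind_le (p := 6) le_rfl fun μ => ?_
    rcases r with _ | ⟨j, v⟩
    · exact (ih (t + 1) μ).trans (by omega)
    refine Timed.steps_bind_le (p := 1) le_rfl fun μ => ?_
    refine Timed.steps_bind_le (steps_foldlM_subtract_le ar ω j v μ) fun μ => ?_
    exact Timed.steps_bind_le (steps_foldlM_refresh_le ar ω j i μ) fun μ => ih (t + 1) μ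

theorem steps_decode_le (k : ℕ) (y : Fin M × Fin 2 → ℂ) :
    (decode ar ω pick k y).steps ≤ M * 31 + k * (35 + 37 * d) := by
  have cost : M * 31 + k * (35 + 37 * d) = M * 4 + (M * 27 + (k * (35 + 37 * d) + 0)) := by ring
  have hload (μ : Memory n M) : ((List.finRange M).foldlM (load ar y) μ).steps ≤ M * 4 := by
    simpa only [List.length_finRange] using
      Timed.steps_foldlM_le (f := load ar y) (p := 4) (fun _ _ => le_rfl) (List.finRange M) μ
  have hrefresh (μ : Memory n M) :
      ((List.finRange M).foldlM (refresh ar ω) μ).steps ≤ M * 27 := by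
    simpa only [List.length_finRange] using
      Timed.steps_foldlM_le (steps_refresh_le ar ω) (List.finRange M) μ
  rw [cost]
  refine Timed.steps_bind_le (hload _) fun μ => Timed.steps_bind_le (hrefresh μ) fun μ => ?_
  exact Timed.steps_bind_le (steps_peel_le ar ω pick k 0 μ) fun _ => le_rfl

end Steps

theorem one_le_logb_natCast (hn : 2 ≤ n) : 1 ≤ logb 2 n := by
  rw [le_logb_iff_rpow_le one_lt_two (by positivity), rpow_one]
  exact_mod_cast hn

theorem clog_le_two_mul_logb (hn : 2 ≤ n) : (Nat.clog 2 n : ℝ) ≤ 2 * logb 2 n := by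
  have hceil : (⌈logb 2 n⌉ : ℝ) = Nat.clog 2 n := by
    exact_mod_cast (Real.ceil_logb_natCast (b := 2) n.cast_nonneg).trans (Int.clog_natCast 2 n)
  linarith [Int.ceil_lt_add_one (logb 2 n), one_le_logb_natCast hn]

theorem clog_mul_le_add_clog {c k : ℕ} (hkn : k ≤ n) :
    Nat.clog 2 (c * k) ≤ c + Nat.clog 2 n := by
  refine Nat.clog_le_of_le_pow ?_
  rw [pow_add]
  exact Nat.mul_le_mul Nat.lt_two_pow_self.le (hkn.trans (Nat.le_pow_clog one_lt_two n))

theorem wordBits_le {c k P : ℕ} (hn : 2 ≤ n) (hkn : k ≤ n) (K : ℕ) :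
    (wordBits (K * (Nat.clog 2 n + P)) n (c * k) : ℝ)
      ≤ (8 * K + 8 + c) * (logb 2 n + P) := by
  have hlog := one_le_logb_natCast hn
  have hclog := clog_le_two_mul_logb hn
  have hck : (Nat.clog 2 (c * k) : ℝ) ≤ c + Nat.clog 2 n := by
    exact_mod_cast clog_mul_le_add_clog hkn
  have : (0 : ℝ) ≤ P := P.cast_nonneg
  have hK : (K : ℝ) * (Nat.clog 2 n + P) ≤ K * (2 * (logb 2 n + P)) := by
    gcongr
    linarith
  have hc : (c : ℝ) * 1 ≤ c * (logb 2 n + P) := by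
    gcongr
    linarith
  calc (wordBits (K * (Nat.clog 2 n + P)) n (c * k) : ℝ)
      = 4 * (K * (Nat.clog 2 n + P)) + 4 + Nat.clog 2 n + Nat.clog 2 (c * k) := by
        unfold wordBits
        push_cast
        ring
    _ ≤ (8 * K + 8 + c) * (logb 2 n + P) := by linarith

theorem steps_decode_le_mul {c k : ℕ} (ar : Arith) (ω : Design n (c * k) d B)
    (pick : ℕ → Finset (Fin (c * k)) → Fin (c * k)) (y : Fin (c * k) × Fin 2 → ℂ) :
    ((decode ar ω pick k y).steps : ℝ) ≤ (31 * c + 35 + 37 * d) * k := by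
  calc ((decode ar ω pick k y).steps : ℝ)
    _ ≤ (c * k * 31 + k * (35 + 37 * d) : ℕ) := by
        exact_mod_cast steps_decode_le ar ω pick k y
    _ = (31 * c + 35 + 37 * d) * k := by
        push_cast
        ring

theorem steps_decode_mul_wordBits_le {c k P : ℕ} (hn : 2 ≤ n) (hkn : k ≤ n) (K : ℕ) (ar : Arith)
    (ω : Design n (c * k) d B) (pick : ℕ → Finset (Fin (c * k)) → Fin (c * k))
    (y : Fin (c * k) × Fin 2 → ℂ) :
    ((decode ar ω pick k y).steps : ℝ) * wordBits (K * (Nat.clog 2 n + P)) n (c * k) ≤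
      (31 * c + 35 + 37 * d) * (8 * K + 8 + c) * (k * (logb 2 n + P)) := by
  calc ((decode ar ω pick k y).steps : ℝ) * wordBits (K * (Nat.clog 2 n + P)) n (c * k)
    _ ≤ (31 * c + 35 + 37 * d) * k * ((8 * K + 8 + c) * (logb 2 n + P)) := by
        gcongr
        · exact steps_decode_le_mul ar ω pick y
        · exact wordBits_le hn hkn K
    _ = (31 * c + 35 + 37 * d) * (8 * K + 8 + c) * (k * (logb 2 n + P)) := by ring

/-! ## Values computed by the decoder -/

/-- The computed phase modulo `π` of the residual `u`. -/
noncomputable def phaseModPi (ar : Arith) (u : ℂ) : ℝ :=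
  if ar.rnd u.arg < 0 then ar.rnd (ar.rnd u.arg + ar.rnd π) else ar.rnd u.arg

/-- The computed number of the left node whose identification weight has the phase of `u`, before
it is rounded to an integer. -/
noncomputable def phaseIndex (ar : Arith) (n : ℕ) (u : ℂ) : ℝ :=
  ar.rnd (phaseModPi ar u * ar.rnd (2 * n / π))

open Classical in
/-- The first half of the leaf test for a graph with neighbourhoods `N`: the left node read off the
identification residual `u` at `i`, if it is a neighbour of `i`. -/
noncomputable def candidate (ar : Arith) (N : Fin n → Finset (Fin M)) (u : ℂ) (i : Fin M) :
    Option (Fin n) :=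
  if ar.rnd ‖u‖ ≤ ar.tol then none
  else if ar.rnd |phaseIndex ar n u - round (phaseIndex ar n u)| ≤ ar.tol then
    (toNode n (round (phaseIndex ar n u))).filter (i ∈ N ·)
  else none

/-- The value that the leaf test reads off the identification residual `u` for the candidate `j`. -/
noncomputable def entry (ar : Arith) (u : ℂ) (j : Fin n) : ℝ :=
  (ar.rndC (u / ar.rndC (coefI j))).re

/-- The computed distance between `v` times the verification weight `a` and the residual `w`. -/
noncomputable def discrepancy (ar : Arith) (a : ℂ) (v : ℝ) (w : ℂ) : ℝ :=
  ar.rnd ‖ar.rndC (ar.rndC (ar.rndC a * v) - w)‖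

/-- A residual `u` after the computed subtraction of `v` times the weight `a`. -/
noncomputable def reduce (ar : Arith) (a : ℂ) (v : ℝ) (u : ℂ) : ℂ :=
  ar.rndC (u - ar.rndC (ar.rndC a * v))

/-- The memory after the measurements have been read. -/
noncomputable def Memory.ofMeasurement (ar : Arith) (y : Fin M × Fin 2 → ℂ) : Memory n M :=
  ⟨fun i => ar.rndC (y (i, 0)), fun i => ar.rndC (y (i, 1)), 0, ∅⟩

/-- The memory after the left node `j` has been decoded with value `v`, before the list of leaf
nodes is brought up to date. -/
noncomputable def Memory.decodeNode (ar : Arith) (ω : Design n M d B) (j : Fin n) (v : ℝ)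
    (μ : Memory n M) : Memory n M :=
  { μ with
    resI := fun i => if i ∈ nbrs ω j then reduce ar (coefI j) v (μ.resI i) else μ.resI i
    resV := fun i => if i ∈ nbrs ω j then reduce ar (coefV ω i j) v (μ.resV i) else μ.resV i
    xhat := Function.update μ.xhat j v }

/-- The right nodes that pass the leaf test. -/
noncomputable def passing (ar : Arith) (ω : Design n M d B) (μ : Memory n M) : Finset (Fin M) :=
  {i | ((leafTest ar ω μ i).val).isSome}

section Values

variable (ar : Arith) (ω : Design n M d B)

open Classical in
theorem val_leafTest (μ : Memory n M) (i : Fin M) :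
    (leafTest ar ω μ i).val = (candidate ar (nbrs ω) (μ.resI i) i).bind fun j =>
      if discrepancy ar (coefV ω i j) (entry ar (μ.resI i) j) (μ.resV i) ≤ ar.tol then
        some (j, entry ar (μ.resI i) j) else none := by
  unfold leafTest candidate phaseIndex phaseModPi
  simp only [Timed.val_step_bind, Timed.val_ite, Timed.val_pure, decide_eq_true_eq]
  generalize toNode n _ = o
  rcases o with _ | j
  · simp [Timed.val_pure]
  · simp only [Timed.val_step_bind, Timed.val_ite, Timed.val_pure, decide_eq_true_eq,
      Option.filter_some, entry, discrepancy]
    by_cases hij : i ∈ nbrs ω j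
    · simp only [hij, if_true]
      split_ifs <;> simp [*]
    · simp [hij]

theorem passing_congr {μ ν : Memory n M} (hI : μ.resI = ν.resI) (hV : μ.resV = ν.resV) :
    passing ar ω μ = passing ar ω ν := by
  simp only [passing, val_leafTest, hI, hV]

variable {ar ω}

theorem val_foldlM_residuals {F : Memory n M → Fin M → Timed (Memory n M)} {g h : Fin M → ℂ → ℂ}
    (hF : ∀ μ i, (F μ i).val =
      { μ with resI := Function.update μ.resI i (g i (μ.resI i))
               resV := Function.update μ.resV i (h i (μ.resV i)) })
    {l : List (Fin M)} (hl : l.Nodup) (μ : Memory n M) :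
    (l.foldlM F μ).val =
      { μ with resI := fun i => if i ∈ l then g i (μ.resI i) else μ.resI i
               resV := fun i => if i ∈ l then h i (μ.resV i) else μ.resV i } := by
  induction l generalizing μ with
  | nil => simp [Timed.val_pure]
  | cons a l ih =>
    obtain ⟨hal, hl⟩ := List.nodup_cons.1 hl
    rw [List.foldlM_cons, Timed.val_bind, ih hl, hF]
    congr 1 <;> funext i <;> rcases eq_or_ne i a with rfl | hia <;> simp [*]

theorem val_foldlM_load (y : Fin M × Fin 2 → ℂ) :
    ((List.finRange M).foldlM (load ar y) (⟨0, 0, 0, ∅⟩ : Memory n M)).val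
      = .ofMeasurement ar y := by
  rw [val_foldlM_residuals (g := fun i _ => ar.rndC (y (i, 0)))
    (h := fun i _ => ar.rndC (y (i, 1))) (fun _ _ => rfl) (List.nodup_finRange M)]
  simp [Memory.ofMeasurement]

theorem val_foldlM_subtract (j : Fin n) (v : ℝ) (μ : Memory n M) :
    ((nbrList ω j).foldlM (subtract ar ω j v)
      { μ with xhat := Function.update μ.xhat j v }).val = μ.decodeNode ar ω j v := by
  rw [val_foldlM_residuals (g := fun _ => reduce ar (coefI j) v)
    (h := fun i => reduce ar (coefV ω i j) v) (fun _ _ => rfl) (nodup_nbrList ω j)]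
  simp [Memory.decodeNode, mem_nbrList]

theorem val_refresh (μ : Memory n M) (a : Fin M) :
    (refresh ar ω μ a).val =
      { μ with leaf := if a ∈ passing ar ω μ then insert a μ.leaf else μ.leaf.erase a } := by
  unfold refresh
  rw [Timed.val_bind]
  rcases h : (leafTest ar ω μ a).val with _ | r <;> simp [passing, h, setOp]

theorem val_foldlM_refresh (l : List (Fin M)) (μ : Memory n M) :
    (l.foldlM (refresh ar ω) μ).val =
      { μ with leaf := {i ∈ μ.leaf | i ∉ l} ∪ {i ∈ passing ar ω μ | i ∈ l} } := by
  induction l generalizing μ with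
  | nil => simp [Timed.val_pure]
  | cons a l ih =>
    rw [List.foldlM_cons, Timed.val_bind, ih, val_refresh]
    have hpassing (L : Finset (Fin M)) : passing ar ω { μ with leaf := L } = passing ar ω μ :=
      passing_congr ar ω rfl rfl
    congr 1
    ext i
    rcases eq_or_ne i a with rfl | hia
    · by_cases hi : i ∈ passing ar ω μ <;> simp [hpassing, hi, (em (i ∈ l)).symm]
    · by_cases ha : a ∈ passing ar ω μ <;> simp [hpassing, ha, hia]

variable {pick : ℕ → Finset (Fin M) → Fin M} {t : ℕ} {μ : Memory n M}

theorem val_peel_of_leaf_eq_empty (f : ℕ) (h : μ.leaf = ∅) :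
    (peel ar ω pick f t μ).val = μ := by
  cases f with
  | zero => rfl
  | succ f =>
    unfold peel
    simp [h, Timed.val_step_bind, Timed.val_pure]

theorem val_peel_succ (f : ℕ) (hleaf : μ.leaf ≠ ∅) {i : Fin M} (hi : pick t μ.leaf = i)
    {j : Fin n} {v : ℝ} (hj : (leafTest ar ω μ i).val = some (j, v)) :
    (peel ar ω pick (f + 1) t μ).val = (peel ar ω pick f (t + 1)
      { μ.decodeNode ar ω j v with
        leaf := {a ∈ μ.leaf.erase i | a ∉ (nbrList ω j).erase i} ∪
          {a ∈ passing ar ω (μ.decodeNode ar ω j v) | a ∈ (nbrList ω j).erase i} }).val := by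
  subst hi
  conv_lhs => unfold peel
  simp only [Timed.val_step_bind, hleaf, decide_false, Bool.false_eq_true, if_false]
  rw [Timed.val_setOp_bind, Timed.val_bind, hj]
  simp only [Timed.val_setOp_bind, Timed.val_step_bind]
  rw [Timed.val_bind, Timed.val_bind, val_foldlM_refresh,
    val_foldlM_subtract j v { μ with leaf := μ.leaf.erase (pick t μ.leaf) }]
  rw [passing_congr ar ω (ν := μ.decodeNode ar ω j v) rfl rfl]
  rfl

theorem val_decode (pick : ℕ → Finset (Fin M) → Fin M) (k : ℕ) (y : Fin M × Fin 2 → ℂ) :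
    (decode ar ω pick k y).val = (peel ar ω pick k 0
      { Memory.ofMeasurement ar y with leaf := passing ar ω (.ofMeasurement ar y) }).val.xhat := by
  unfold decode
  rw [Timed.val_bind, Timed.val_bind, Timed.val_bind, val_foldlM_load, val_foldlM_refresh]
  simp [Timed.val_pure, Memory.ofMeasurement]

end Values

end Decoder

/-! ## Uniform probability on a finite type -/

section Prob

variable {Ω : Type} [Fintype Ω] {E F : Set Ω}

theorem prob_eq_expect (E : Set Ω) [DecidablePred (· ∈ E)] :
    prob E = 𝔼 ω, if ω ∈ E then (1 : ℝ) else 0 := by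
  rw [prob, Fintype.expect_eq_sum_div_card, Finset.sum_boole, Set.ncard_eq_toFinset_card']
  congr 2
  exact congrArg _ (Finset.ext fun ω => by simp)

theorem prob_nonneg (E : Set Ω) : 0 ≤ prob E := by
  unfold prob
  positivity

theorem prob_le_one (E : Set Ω) : prob E ≤ 1 := by
  refine div_le_one_of_le₀ ?_ (Nat.cast_nonneg _)
  exact_mod_cast (Set.ncard_le_card E).trans_eq Nat.card_eq_fintype_card

theorem prob_empty : prob (∅ : Set Ω) = 0 := by
  simp [prob]

theorem prob_mono (h : E ⊆ F) : prob E ≤ prob F := by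
  unfold prob
  gcongr
  exact F.toFinite

theorem prob_compl [Nonempty Ω] (E : Set Ω) : prob Eᶜ = 1 - prob E := by
  have h : (E.ncard : ℝ) + Eᶜ.ncard = Fintype.card Ω := by
    exact_mod_cast (Set.ncard_add_ncard_compl E).trans Nat.card_eq_fintype_card
  unfold prob
  field_simp
  linarith

theorem prob_union_le (E F : Set Ω) : prob (E ∪ F) ≤ prob E + prob F := by
  unfold prob
  rw [← add_div]
  gcongr
  exact_mod_cast Set.ncard_union_le E F

theorem prob_biUnion_le {ι : Type*} (s : Finset ι) (E : ι → Set Ω) :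
    prob (⋃ i ∈ s, E i) ≤ ∑ i ∈ s, prob (E i) := by
  classical
  induction s using Finset.induction with
  | empty => simp [prob_empty]
  | insert a s ha ih =>
    rw [Finset.set_biUnion_insert, Finset.sum_insert ha]
    exact (prob_union_le _ _).trans (by gcongr)

theorem prob_lt_le_expect_div {f : Ω → ℝ} (hf : ∀ ω, 0 ≤ f ω) {a : ℝ} (ha : 0 < a) :
    prob {ω | a < f ω} ≤ (𝔼 ω, f ω) / a := by
  classical
  rw [prob_eq_expect, le_div_iff₀ ha, Finset.expect_mul]
  refine Finset.expect_le_expect fun ω _ => ?_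
  by_cases h : a < f ω
  · simpa [h] using h.le
  · simpa [h] using hf ω

theorem prob_prod_le {Ω' : Type} [Fintype Ω'] {G : Set Ω} {E : Set (Ω × Ω')} {p q : ℝ}
    (hG : prob Gᶜ ≤ p) (hq : 0 ≤ q) (hE : ∀ ω ∈ G, prob {ω' | (ω, ω') ∈ E} ≤ q) :
    prob E ≤ p + q := by
  classical
  have hfiber (ω : Ω) : prob {ω' | (ω, ω') ∈ E} ≤ (if ω ∈ Gᶜ then (1 : ℝ) else 0) + q := by
    by_cases hω : ω ∈ G
    · simpa [hω] using hE ω hω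
    · simpa [hω] using (prob_le_one _).trans (le_add_of_nonneg_right hq)
  calc prob E = 𝔼 ω, prob {ω' | (ω, ω') ∈ E} := by
        simp only [prob_eq_expect, Set.mem_ofPred_eq]
        exact Finset.expect_product Finset.univ Finset.univ _
    _ ≤ 𝔼 ω, ((if ω ∈ Gᶜ then (1 : ℝ) else 0) + q) := Finset.expect_le_expect fun ω _ => hfiber ω
    _ ≤ p + q := by
        rw [Finset.expect_add_distrib, ← prob_eq_expect]
        refine add_le_add hG ?_
        rcases isEmpty_or_nonempty Ω with hΩ | hΩ
        · simpa using hq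
        · rw [Fintype.expect_const]

theorem le_prob_prod {Ω' : Type} [Fintype Ω'] [Nonempty (Ω × Ω')] {G : Set Ω} {E : Set (Ω × Ω')}
    {p q : ℝ} (hG : prob Gᶜ ≤ p) (hq : 0 ≤ q) (hE : ∀ ω ∈ G, prob {ω' | (ω, ω') ∉ E} ≤ q) :
    1 - (p + q) ≤ prob E := by
  have hcompl := prob_prod_le (E := Eᶜ) hG hq hE
  rw [prob_compl] at hcompl
  linarith

end Prob

section Pi

variable {ι α : Type} [Fintype ι] [DecidableEq ι] [Fintype α]

theorem expect_expect_update (F : (ι → α) → ℝ) (j : ι) :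
    𝔼 g : ι → α, 𝔼 s : α, F (Function.update g j s) = 𝔼 g, F g := by
  rcases isEmpty_or_nonempty α with hα | hα
  · have : IsEmpty (ι → α) := ⟨fun g => hα.elim (g j)⟩
    simp
  let swap : (ι → α) × α ≃ (ι → α) × α :=
    { toFun := fun p => (Function.update p.1 j p.2, p.1 j)
      invFun := fun p => (Function.update p.1 j p.2, p.1 j)
      left_inv := fun p => by simp
      right_inv := fun p => by simp }
  calc 𝔼 g : ι → α, 𝔼 s : α, F (Function.update g j s)
      = 𝔼 p : (ι → α) × α, F (swap p).1 :=
        (Finset.expect_product' Finset.univ Finset.univ fun g s => F (Function.update g j s)).symm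
    _ = 𝔼 p : (ι → α) × α, F p.1 :=
        Fintype.expect_equiv swap (fun p => F (swap p).1) (fun p => F p.1) fun _ => rfl
    _ = 𝔼 g : ι → α, 𝔼 _s : α, F g :=
        Finset.expect_product' Finset.univ Finset.univ fun g (_s : α) => F g
    _ = 𝔼 g, F g := by simp only [Fintype.expect_const]

theorem prob_le_of_forall_update {E : Set (ι → α)} (j : ι) {q : ℝ} (hq : 0 ≤ q)
    (h : ∀ g, prob {s | Function.update g j s ∈ E} ≤ q) : prob E ≤ q := by
  classical
  rw [prob_eq_expect, ← expect_expect_update _ j]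
  rcases isEmpty_or_nonempty (ι → α) with hα | hα
  · simpa using hq
  refine (Finset.expect_le_expect fun g _ => ?_).trans_eq (Fintype.expect_const q)
  simpa only [prob_eq_expect, Set.mem_ofPred_eq] using h g

theorem expect_ite_le_of_indep {Q : α → (ι → α) → Prop} [∀ s g, Decidable (Q s g)]
    {H : (ι → α) → ℝ} {j : ι} {q : ℝ} (hH₀ : ∀ g, 0 ≤ H g)
    (hH : ∀ g s, H (Function.update g j s) = H g)
    (hQ : ∀ s' g s, Q s' (Function.update g j s) ↔ Q s' g)
    (hq : ∀ g, prob {s | Q s g} ≤ q) :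
    𝔼 g, (if Q (g j) g then H g else 0) ≤ q * 𝔼 g, H g := by
  classical
  rw [← expect_expect_update _ j, Finset.mul_expect]
  refine Finset.expect_le_expect fun g _ => ?_
  calc 𝔼 s, (if Q (Function.update g j s j) (Function.update g j s)
          then H (Function.update g j s) else 0)
      = prob {s | Q s g} * H g := by
        simp only [Function.update_self, hQ, hH, prob_eq_expect, Finset.expect_mul, ite_mul,
          one_mul, zero_mul, Set.mem_ofPred_eq]
    _ ≤ q * H g := mul_le_mul_of_nonneg_right (hq g) (hH₀ g)

theorem prob_forall_mem_le (S : Finset ι) (E : Set α) :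
    prob {g : ι → α | ∀ j ∈ S, g j ∈ E} ≤ prob E ^ S.card := by
  classical
  induction S using Finset.induction with
  | empty => simpa using prob_le_one Set.univ
  | insert a S ha ih =>
    have hne {j : ι} (hj : j ∈ S) : j ≠ a := fun h => ha (h ▸ hj)
    have hrec := expect_ite_le_of_indep (j := a) (Q := fun s _ => s ∈ E)
      (H := fun g : ι → α => if ∀ j ∈ S, g j ∈ E then (1 : ℝ) else 0) (q := prob E)
      (fun g => by positivity)
      (fun g s => by
        congr 1
        exact propext (forall₂_congr fun j hj => by rw [Function.update_of_ne (hne hj)]))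
      (fun _ _ _ => Iff.rfl) (fun _ => le_rfl)
    rw [Finset.card_insert_of_notMem ha, pow_succ']
    refine le_trans (le_of_eq ?_) (hrec.trans (mul_le_mul_of_nonneg_left ?_ (prob_nonneg E)))
    · rw [prob_eq_expect]
      simp only [Set.mem_ofPred_eq, Finset.forall_mem_insert, ite_and]
    · simpa only [prob_eq_expect, Set.mem_ofPred_eq] using ih

end Pi

/-! ## Walks in a random graph -/

theorem choose_mul_pow_le {m M : ℕ} (h : m ≤ M) (d : ℕ) :
    m.choose d * M ^ d ≤ M.choose d * m ^ d := by
  have key : m.descFactorial d * M ^ d ≤ M.descFactorial d * m ^ d := by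
    induction d with
    | zero => simp
    | succ d ih =>
      have hfactor : (m - d) * M ≤ (M - d) * m := by
        rw [Nat.sub_mul, Nat.sub_mul, Nat.mul_comm M m]
        exact Nat.sub_le_sub_left (Nat.mul_le_mul_left d h) _
      calc m.descFactorial (d + 1) * M ^ (d + 1)
          = ((m - d) * M) * (m.descFactorial d * M ^ d) := by
            rw [Nat.descFactorial_succ, pow_succ]
            ring
        _ ≤ ((M - d) * m) * (M.descFactorial d * m ^ d) := Nat.mul_le_mul hfactor ih
        _ = M.descFactorial (d + 1) * m ^ (d + 1) := by
            rw [Nat.descFactorial_succ, pow_succ]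
            ring
  rw [Nat.descFactorial_eq_factorial_mul_choose, Nat.descFactorial_eq_factorial_mul_choose,
    mul_assoc, mul_assoc] at key
  exact Nat.le_of_mul_le_mul_left key d.factorial_pos

/-- The type of the subsets of `W` with `d` elements: the possible neighbourhoods of a left node. -/
abbrev SubsetsOfCard (W : Type) (d : ℕ) : Type := {s : Finset W // s.card = d}

section SubsetsOfCard

variable {W : Type} [Fintype W] {d : ℕ}

theorem nonempty_subsetsOfCard (h : d ≤ Fintype.card W) : Nonempty (SubsetsOfCard W d) := by
  obtain ⟨s, -, hs⟩ := Finset.exists_subset_card_eq (s := (Finset.univ : Finset W)) h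
  exact ⟨⟨s, hs⟩⟩

theorem prob_subset (R : Finset W) :
    prob {s : SubsetsOfCard W d | s.1 ⊆ R} = R.card.choose d / (Fintype.card W).choose d := by
  have h : Subtype.val '' {s : SubsetsOfCard W d | s.1 ⊆ R} = R.powersetCard d := by
    ext s
    simp [and_comm]
  rw [prob, Fintype.card_finset_len, ← Set.ncard_image_of_injective _ Subtype.val_injective, h,
    Set.ncard_coe_finset, Finset.card_powersetCard]

theorem prob_subset_le (R : Finset W) :
    prob {s : SubsetsOfCard W d | s.1 ⊆ R} ≤ ((R.card : ℝ) / Fintype.card W) ^ d := by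
  rw [prob_subset]
  rcases Nat.eq_zero_or_pos ((Fintype.card W).choose d) with h0 | hpos
  · rw [h0, Nat.cast_zero, div_zero]
    positivity
  have hpow : 0 < Fintype.card W ^ d := by
    rcases Nat.eq_zero_or_pos d with rfl | hd
    · simp
    · exact Nat.pow_pos (hd.trans_le (le_of_not_gt fun h =>
        hpos.ne' (Nat.choose_eq_zero_of_lt h)))
  rw [div_pow, div_le_div_iff₀ (by exact_mod_cast hpos) (by exact_mod_cast hpow),
    mul_comm ((R.card : ℝ) ^ d)]
  exact_mod_cast choose_mul_pow_le R.card_le_univ d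

theorem prob_mem_le (i : W) :
    prob {s : SubsetsOfCard W d | i ∈ s.1} ≤ (d : ℝ) / Fintype.card W := by
  classical
  rcases lt_or_ge (Fintype.card W) d with hlt | hle
  · have : IsEmpty (SubsetsOfCard W d) := ⟨fun s => (s.2 ▸ s.1.card_le_univ).not_gt hlt⟩
    rw [Set.eq_empty_of_isEmpty {s : SubsetsOfCard W d | i ∈ s.1}, prob_empty]
    positivity
  have := nonempty_subsetsOfCard hle
  have hcompl : {s : SubsetsOfCard W d | i ∈ s.1} = {s | s.1 ⊆ Finset.univ.erase i}ᶜ := by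
    ext s
    simp [Finset.subset_erase]
  obtain ⟨m, hm⟩ : ∃ m, Fintype.card W = m + 1 :=
    Nat.exists_eq_succ_of_ne_zero (Fintype.card_pos_iff.2 ⟨i⟩).ne'
  have hchoose : (m.choose d : ℝ) * (m + 1) = (m + 1).choose d * (m + 1 - d) := by
    have h := Nat.choose_mul_succ_eq m d
    rw [← Nat.cast_inj (R := ℝ)] at h
    push_cast [Nat.cast_sub (hm ▸ hle)] at h
    exact h
  have hpos : (0 : ℝ) < (m + 1).choose d := by exact_mod_cast Nat.choose_pos (hm ▸ hle)
  rw [hcompl, prob_compl, prob_subset, Finset.card_erase_of_mem (Finset.mem_univ i),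
    Finset.card_univ, hm, Nat.add_sub_cancel, Nat.cast_succ]
  refine le_of_eq ?_
  field_simp
  linarith

theorem prob_not_disjoint_le (R : Finset W) :
    prob {s : SubsetsOfCard W d | ¬ Disjoint s.1 R} ≤ R.card * d / Fintype.card W := by
  classical
  have hunion : {s : SubsetsOfCard W d | ¬ Disjoint s.1 R} = ⋃ i ∈ R, {s | i ∈ s.1} := by
    ext s
    simp [Finset.not_disjoint_iff, and_comm]
  calc prob {s : SubsetsOfCard W d | ¬ Disjoint s.1 R}
      ≤ ∑ i ∈ R, prob {s : SubsetsOfCard W d | i ∈ s.1} := hunion ▸ prob_biUnion_le R _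
    _ ≤ ∑ _i ∈ R, (d : ℝ) / Fintype.card W := Finset.sum_le_sum fun i _ => prob_mem_le i
    _ = R.card * d / Fintype.card W := by rw [Finset.sum_const, nsmul_eq_mul, mul_div_assoc]

end SubsetsOfCard

section Walks

variable {V W : Type} [DecidableEq V] [DecidableEq W]

/-- Weighted number of self-avoiding walks with at most `r` steps that start in the left node `j`,
continue in `T`, and step between left nodes with a common neighbour, where `N` gives the
neighbourhoods; every step has the weight two. It controls how far a decoding error spreads, since
the error of a decoded entry is passed on to the entries that share a neighbour with it. -/
noncomputable def walks (N : V → Finset W) : ℕ → Finset V → V → ℝ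
  | 0, _, _ => 1
  | r + 1, T, j =>
    1 + 2 * ∑ j' ∈ T, if ¬ Disjoint (N j) (N j') then walks N r (T.erase j') j' else 0

theorem one_le_walks (N : V → Finset W) (r : ℕ) (T : Finset V) (j : V) : 1 ≤ walks N r T j := by
  induction r generalizing T j with
  | zero => exact le_rfl
  | succ r ih =>
    refine le_add_of_nonneg_right (mul_nonneg zero_le_two (Finset.sum_nonneg fun j' _ => ?_))
    split_ifs
    · exact le_rfl
    · exact zero_le_one.trans (ih _ _)

theorem walks_nonneg (N : V → Finset W) (r : ℕ) (T : Finset V) (j : V) : 0 ≤ walks N r T j :=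
  zero_le_one.trans (one_le_walks N r T j)

theorem walks_mono (N : V → Finset W) {r r' : ℕ} (hr : r ≤ r') {T T' : Finset V} (hT : T ⊆ T')
    (j : V) : walks N r T j ≤ walks N r' T' j := by
  induction r generalizing r' T T' j with
  | zero => exact one_le_walks N r' T' j
  | succ r ih =>
    obtain ⟨r', rfl⟩ := Nat.exists_eq_add_of_le' (Nat.one_le_of_lt hr)
    unfold walks
    gcongr 1 + 2 * ?_
    refine (Finset.sum_le_sum fun j' _ => ?_).trans
      (Finset.sum_le_sum_of_subset_of_nonneg hT fun j' _ _ => ?_)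
    · split_ifs
      · exact le_rfl
      · exact ih (Nat.le_of_succ_le_succ hr) (Finset.erase_subset_erase _ hT) j'
    · split_ifs
      · exact le_rfl
      · exact walks_nonneg N r' _ j'

theorem walks_congr {N N' : V → Finset W} (r : ℕ) {T : Finset V} {j : V} (hj : N j = N' j)
    (hT : ∀ a ∈ T, N a = N' a) : walks N r T j = walks N' r T j := by
  induction r generalizing T j with
  | zero => rfl
  | succ r ih =>
    unfold walks
    congr 2
    refine Finset.sum_congr rfl fun j' hj' => ?_
    rw [hj, hT j' hj', ih (hT j' hj') fun a ha => hT a (Finset.mem_of_mem_erase ha)]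

variable [Fintype V] [Fintype W] {d k : ℕ}

theorem expect_walks_step_le (r : ℕ) {T : Finset V} {j j' : V} (hj : j ∉ T) (hj' : j' ∈ T) :
    𝔼 g : V → SubsetsOfCard W d,
        (if ¬ Disjoint (g j).1 (g j').1 then walks (fun a => (g a).1) r (T.erase j') j' else 0)
      ≤ (d : ℝ) ^ 2 / Fintype.card W *
        𝔼 g : V → SubsetsOfCard W d, walks (fun a => (g a).1) r (T.erase j') j' := by
  have hne {a : V} (ha : a ∈ T) : a ≠ j := fun h => hj (h ▸ ha)
  refine expect_ite_le_of_indep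
    (Q := fun (s : SubsetsOfCard W d) g => ¬ Disjoint s.1 (g j').1) (j := j)
    (fun g => walks_nonneg _ _ _ _) (fun g s => ?_) (fun s' g s => ?_) (fun g => ?_)
  · refine walks_congr r ?_ fun a ha => ?_
    · rw [Function.update_of_ne (hne hj')]
    · rw [Function.update_of_ne (hne (Finset.mem_of_mem_erase ha))]
  · rw [Function.update_of_ne (hne hj')]
  · refine (prob_not_disjoint_le (g j').1).trans_eq ?_
    rw [(g j').2, sq]

theorem expect_walks_le_two (hW : 4 * d ^ 2 * k ≤ Fintype.card W) (r : ℕ) {T : Finset V} {j : V}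
    (hj : j ∉ T) (hT : T.card ≤ k) :
    𝔼 g : V → SubsetsOfCard W d, walks (fun a => (g a).1) r T j ≤ 2 := by
  rcases isEmpty_or_nonempty (V → SubsetsOfCard W d) with hemp | hne
  · simp
  induction r generalizing T j with
  | zero =>
    simp only [walks, Fintype.expect_const]
    exact one_le_two
  | succ r ih =>
    have hstep : ∀ j' ∈ T, 𝔼 g : V → SubsetsOfCard W d,
        (if ¬ Disjoint (g j).1 (g j').1 then walks (fun a => (g a).1) r (T.erase j') j' else 0)
        ≤ (d : ℝ) ^ 2 / Fintype.card W * 2 := fun j' hj' =>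
      (expect_walks_step_le r hj hj').trans (mul_le_mul_of_nonneg_left
        (ih (T.notMem_erase j') ((Finset.card_le_card (T.erase_subset j')).trans hT))
        (by positivity))
    have hquarter : (T.card : ℝ) * ((d : ℝ) ^ 2 / Fintype.card W) ≤ 1 / 4 := by
      have hcard : (4 * d ^ 2 * T.card : ℝ) ≤ Fintype.card W := by
        exact_mod_cast (Nat.mul_le_mul_left _ hT).trans hW
      rw [← mul_div_assoc]
      exact div_le_of_le_mul₀ (Nat.cast_nonneg _) (by norm_num) (by linarith)
    simp only [walks]
    rw [Finset.expect_add_distrib, Fintype.expect_const, ← Finset.mul_expect,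
      Finset.expect_sum_comm]
    have hsum := Finset.sum_le_sum hstep
    rw [Finset.sum_const, nsmul_eq_mul] at hsum
    linarith

end Walks

/-! ## Leafless sets -/

section Leafless

variable {V W : Type} [Fintype W] [DecidableEq W]

/-- The right nodes with exactly one neighbour in `S`: those whose measurement determines an entry
of a signal with support `S`. -/
def leaves (N : V → Finset W) (S : Finset V) : Finset W :=
  Finset.univ.filter fun i => (S.filter (i ∈ N ·)).card = 1

theorem mem_leaves {N : V → Finset W} {S : Finset V} {i : W} :
    i ∈ leaves N S ↔ (S.filter (i ∈ N ·)).card = 1 := by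
  simp only [leaves, Finset.mem_filter_univ]

theorem two_mul_card_biUnion_le {d : ℕ} {N : V → Finset W} (hN : ∀ j, (N j).card = d)
    {S : Finset V} (hS : leaves N S = ∅) : 2 * (S.biUnion N).card ≤ d * S.card := by
  have hedges : ∑ i ∈ S.biUnion N, (S.filter (i ∈ N ·)).card = d * S.card := by
    have hdeg : ∀ j ∈ S, ((S.biUnion N).filter (· ∈ N j)).card = d := fun j hj => by
      rw [Finset.filter_mem_eq_inter,
        Finset.inter_eq_right.2 (Finset.subset_biUnion_of_mem N hj), hN]
    calc ∑ i ∈ S.biUnion N, (S.filter (i ∈ N ·)).card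
        = ∑ j ∈ S, ((S.biUnion N).filter (· ∈ N j)).card :=
          Finset.sum_card_bipartiteAbove_eq_sum_card_bipartiteBelow fun i j => i ∈ N j
      _ = d * S.card := by rw [Finset.sum_const_nat hdeg, mul_comm]
  rw [← hedges, mul_comm, ← smul_eq_mul, ← Finset.sum_const]
  refine Finset.sum_le_sum fun i hi => ?_
  obtain ⟨j, hj, hij⟩ := Finset.mem_biUnion.1 hi
  have hpos : 0 < (S.filter (i ∈ N ·)).card :=
    Finset.card_pos.2 ⟨j, Finset.mem_filter.2 ⟨hj, hij⟩⟩
  have hne : (S.filter (i ∈ N ·)).card ≠ 1 := fun h => by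
    simpa [hS] using mem_leaves.2 h
  omega

/-- Some nonempty subset of `S₀` has no leaf. If there is none, then peeling does not end before
all entries with index in `S₀` are decoded. -/
def Leafless (N : V → Finset W) (S₀ : Finset V) : Prop :=
  ∃ S ⊆ S₀, S.Nonempty ∧ leaves N S = ∅

theorem prob_leaves_eq_empty_le [Fintype V] [DecidableEq V] {d : ℕ} (S : Finset V)
    (hW : d * S.card / 2 ≤ Fintype.card W) :
    prob {g : V → SubsetsOfCard W d | leaves (fun j => (g j).1) S = ∅} ≤
      (Fintype.card W).choose (d * S.card / 2) *
        (((d * S.card / 2 : ℕ) : ℝ) / Fintype.card W) ^ (d * S.card) := by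
  have hsub : {g : V → SubsetsOfCard W d | leaves (fun j => (g j).1) S = ∅} ⊆
      ⋃ R ∈ Finset.univ.powersetCard (d * S.card / 2),
        {g : V → SubsetsOfCard W d | ∀ j ∈ S, g j ∈ {s : SubsetsOfCard W d | s.1 ⊆ R}} := by
    intro g hg
    have hcard := two_mul_card_biUnion_le (fun j => (g j).2) hg
    obtain ⟨R, hR, -, hRcard⟩ := Finset.exists_subsuperset_card_eq
      (Finset.subset_univ (S.biUnion fun j => (g j).1)) (n := d * S.card / 2) (by omega) hW
    refine Set.mem_biUnion (Finset.mem_powersetCard.2 ⟨Finset.subset_univ R, hRcard⟩) ?_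
    exact fun j hj => (Finset.subset_biUnion_of_mem (fun j => (g j).1) hj).trans hR
  refine (prob_mono hsub).trans ((prob_biUnion_le _ _).trans ?_)
  have hR : ∀ R ∈ Finset.univ.powersetCard (d * S.card / 2),
      prob {g : V → SubsetsOfCard W d | ∀ j ∈ S, g j ∈ {s : SubsetsOfCard W d | s.1 ⊆ R}} ≤
        (((d * S.card / 2 : ℕ) : ℝ) / Fintype.card W) ^ (d * S.card) := fun R hR => by
    refine (prob_forall_mem_le S _).trans ?_
    rw [pow_mul, ← (Finset.mem_powersetCard.1 hR).2]
    exact pow_le_pow_left₀ (prob_nonneg _) (prob_subset_le R) _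
  have hsum := Finset.sum_le_card_nsmul _ _ _ hR
  rwa [Finset.card_powersetCard, Finset.card_univ, nsmul_eq_mul] at hsum

end Leafless

theorem choose_le_three_mul_div_pow (N r : ℕ) : (N.choose r : ℝ) ≤ (3 * N / r) ^ r := by
  rcases Nat.eq_zero_or_pos r with rfl | hr
  · simp
  have hfactorial : (r : ℝ) ^ r / r.factorial ≤ 3 ^ r := by
    refine (Real.pow_div_factorial_le_exp r (Nat.cast_nonneg _) r).trans ?_
    rw [← mul_one (r : ℝ), Real.exp_nat_mul]
    exact pow_le_pow_left₀ (Real.exp_pos _).le Real.exp_one_lt_three.le r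
  calc (N.choose r : ℝ) ≤ (N : ℝ) ^ r / r.factorial := Nat.choose_le_pow_div r N
    _ = ((N : ℝ) / r) ^ r * ((r : ℝ) ^ r / r.factorial) := by
        rw [div_pow, div_mul_div_cancel₀ (by positivity)]
    _ ≤ ((N : ℝ) / r) ^ r * 3 ^ r := by gcongr
    _ = (3 * N / r) ^ r := by rw [← mul_pow, mul_comm, mul_div_assoc]

theorem choose_mul_div_pow_le {m M r t : ℕ} (hm : 0 < m) (h3 : 3 * m ≤ M) (hr : m + t ≤ r)
    (ht : m ≤ t) : (M.choose m : ℝ) * ((m : ℝ) / M) ^ r ≤ (3 * (m / M)) ^ t := by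
  have hM : 0 < M := by omega
  have h3' : 3 * ((m : ℝ) / M) ≤ 1 := by
    rw [← mul_div_assoc, div_le_one (by positivity)]
    exact_mod_cast h3
  have h1 : (m : ℝ) / M ≤ 1 := by linarith [show (0 : ℝ) ≤ m / M by positivity]
  calc (M.choose m : ℝ) * ((m : ℝ) / M) ^ r
      ≤ (3 * M / m) ^ m * ((m : ℝ) / M) ^ (m + t) := by
        gcongr ?_ * ?_
        · exact choose_le_three_mul_div_pow M m
        · exact pow_le_pow_of_le_one (by positivity) h1 hr
    _ = 3 ^ m * ((m : ℝ) / M) ^ t := by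
        rw [pow_add, ← mul_assoc, ← mul_pow]
        congr 2
        field_simp
    _ ≤ 3 ^ t * ((m : ℝ) / M) ^ t := by gcongr; norm_num
    _ = (3 * (m / M)) ^ t := (mul_pow _ _ _).symm

theorem choose_mul_choose_mul_pow_le {d k M s : ℕ} (hd : 3 ≤ d) (hM : 18 * d * k ≤ M) (hs : 1 ≤ s)
    (hsk : s ≤ k) :
    (k.choose s : ℝ) * ((M.choose (d * s / 2) : ℝ) *
      (((d * s / 2 : ℕ) : ℝ) / M) ^ (d * s)) ≤ (1 / 2) ^ s / k := by
  have hds : 3 * s ≤ d * s := Nat.mul_le_mul_right s hd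
  have hdk : d * s ≤ d * k := Nat.mul_le_mul_left d hsk
  have hMdk : 18 * (d * k) ≤ M := by rwa [← mul_assoc]
  obtain ⟨m, hm⟩ : ∃ m, d * s / 2 = m := ⟨_, rfl⟩
  have hk : 0 < k := hs.trans hsk
  have hM0 : 0 < M := by omega
  have hratio : 3 * ((m : ℝ) / M) ≤ s / k / 12 := by
    have hle : 36 * m * k ≤ s * M := calc
      36 * m * k ≤ 18 * (d * s) * k := Nat.mul_le_mul_right k (by omega)
      _ = s * (18 * d * k) := by ring
      _ ≤ s * M := Nat.mul_le_mul_left s hM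
    have hle' : (36 : ℝ) * m * k ≤ s * M := by exact_mod_cast hle
    rw [div_div, ← mul_div_assoc, div_le_div_iff₀ (by positivity) (by positivity)]
    linarith
  have hlt : (s : ℝ) ≤ 2 ^ s := by exact_mod_cast Nat.lt_two_pow_self.le
  rw [hm]
  calc (k.choose s : ℝ) * ((M.choose m : ℝ) * ((m : ℝ) / M) ^ (d * s))
      ≤ (3 * k / s) ^ s * (3 * (m / M)) ^ (s + 1) := by
        gcongr ?_ * ?_
        · exact choose_le_three_mul_div_pow k s
        · refine (choose_mul_div_pow_le (t := d * s - m) (by omega) (by omega) (by omega)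
            (by omega)).trans (pow_le_pow_of_le_one (by positivity) ?_ (by omega))
          have : (s : ℝ) / k ≤ 1 := div_le_one_of_le₀ (by exact_mod_cast hsk) (by positivity)
          linarith
    _ ≤ (3 * k / s) ^ s * (s / k / 12) ^ (s + 1) := by gcongr
    _ = (1 / 4) ^ s * (s / k / 12) := by
        rw [pow_succ, ← mul_assoc, ← mul_pow]
        congr 2
        field_simp
        norm_num
    _ ≤ (1 / 4) ^ s * (2 ^ s / k / 1) := by gcongr; norm_num
    _ = (1 / 2) ^ s / k := by rw [div_one, ← mul_div_assoc, ← mul_pow]; norm_num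

section RandomGraph

variable {V W : Type} [Fintype V] [DecidableEq V] [Fintype W] [DecidableEq W] {d k : ℕ}

theorem prob_leafless_le (hd : 3 ≤ d) (hW : 18 * d * k ≤ Fintype.card W) {S₀ : Finset V}
    (hS₀ : S₀.card ≤ k) :
    prob {g : V → SubsetsOfCard W d | Leafless (fun j => (g j).1) S₀} ≤ 1 / k := by
  let E (S : Finset V) : Set (V → SubsetsOfCard W d) := {g | leaves (fun j => (g j).1) S = ∅}
  have hsub : {g : V → SubsetsOfCard W d | Leafless (fun j => (g j).1) S₀} ⊆
      ⋃ s ∈ Finset.range k, ⋃ S ∈ S₀.powersetCard (s + 1), E S := by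
    rintro g ⟨S, hS, hne, hleaf⟩
    have hpos := hne.card_pos
    have hle := (Finset.card_le_card hS).trans hS₀
    simp only [Set.mem_iUnion]
    exact ⟨S.card - 1, Finset.mem_range.2 (by omega), S,
      Finset.mem_powersetCard.2 ⟨hS, by omega⟩, hleaf⟩
  have hsize : ∀ s ∈ Finset.range k,
      prob (⋃ S ∈ S₀.powersetCard (s + 1), E S) ≤ (1 / 2) ^ (s + 1) / k := fun s hs => by
    have hsk : s + 1 ≤ k := Finset.mem_range.1 hs
    have hhalf : d * (s + 1) / 2 ≤ Fintype.card W := by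
      have := Nat.mul_le_mul_left d hsk
      have := hW.trans' (Nat.mul_le_mul_right k (Nat.le_mul_of_pos_left d (by norm_num : 0 < 18)))
      omega
    refine (prob_biUnion_le _ _).trans (le_trans ?_
      (choose_mul_choose_mul_pow_le hd hW s.succ_pos hsk))
    have hsum := Finset.sum_le_card_nsmul (S₀.powersetCard (s + 1)) (fun S => prob (E S)) _
      fun S hS => by
        have hcard := (Finset.mem_powersetCard.1 hS).2
        have := prob_leaves_eq_empty_le (d := d) (W := W) S (by rwa [hcard])
        rwa [hcard] at this
    rw [Finset.card_powersetCard, nsmul_eq_mul] at hsum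
    refine hsum.trans ?_
    gcongr
  calc prob {g : V → SubsetsOfCard W d | Leafless (fun j => (g j).1) S₀}
      ≤ ∑ s ∈ Finset.range k, (1 / 2 : ℝ) ^ (s + 1) / k :=
        (prob_mono hsub).trans ((prob_biUnion_le _ _).trans (Finset.sum_le_sum hsize))
    _ = (∑ s ∈ Finset.range k, (1 / 2 : ℝ) ^ s) / 2 / k := by
        rw [Finset.sum_div, Finset.sum_div]
        simp only [pow_succ, mul_one_div]
    _ ≤ 1 / k := by
        gcongr
        linarith [sum_geometric_two_le k]

/-- The total number of walks in `S₀` is large. Otherwise the sum of the errors of all decoded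
entries is at most `2 k²` times the error that a single decoding step makes. -/
def ManyWalks (N : V → Finset W) (k : ℕ) (S₀ : Finset V) : Prop :=
  2 * (k : ℝ) ^ 2 < ∑ j ∈ S₀, walks N k (S₀.erase j) j

theorem prob_manyWalks_le (hk : 1 ≤ k) (hW : 4 * d ^ 2 * k ≤ Fintype.card W) {S₀ : Finset V}
    (hS₀ : S₀.card ≤ k) :
    prob {g : V → SubsetsOfCard W d | ManyWalks (fun j => (g j).1) k S₀} ≤ 1 / k := by
  have : (0 : ℝ) < k := by exact_mod_cast hk
  have hmean : 𝔼 g : V → SubsetsOfCard W d, ∑ j ∈ S₀, walks (fun a => (g a).1) k (S₀.erase j) j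
      ≤ 2 * k := by
    rw [Finset.expect_sum_comm]
    calc ∑ j ∈ S₀, 𝔼 g : V → SubsetsOfCard W d, walks (fun a => (g a).1) k (S₀.erase j) j
        ≤ ∑ _j ∈ S₀, (2 : ℝ) := Finset.sum_le_sum fun j _ => expect_walks_le_two hW k
          (S₀.notMem_erase j) ((Finset.card_le_card (S₀.erase_subset j)).trans hS₀)
      _ = 2 * S₀.card := by rw [Finset.sum_const, nsmul_eq_mul, mul_comm]
      _ ≤ 2 * k := by gcongr
  calc prob {g : V → SubsetsOfCard W d | ManyWalks (fun j => (g j).1) k S₀}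
      ≤ (𝔼 g : V → SubsetsOfCard W d, ∑ j ∈ S₀, walks (fun a => (g a).1) k (S₀.erase j) j)
          / (2 * (k : ℝ) ^ 2) :=
        prob_lt_le_expect_div (fun g => Finset.sum_nonneg fun j _ => walks_nonneg _ _ _ _)
          (by positivity)
    _ ≤ 2 * k / (2 * (k : ℝ) ^ 2) := by gcongr
    _ = 1 / k := by field_simp

end RandomGraph

variable {n M d B k : ℕ}

/-! ## Rounding errors of one decoding step -/

/-- Bound for the error of a residual at the end of a run with rounding errors `ε` on entries of
modulus at most `X`: the error `8 ε X` of one decoding step is amplified by the at most `2 k²` walks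
of a good graph, at most four times. -/
noncomputable def errBound (k : ℕ) (ε X : ℝ) : ℝ := 8 * ε * X * (1 + 8 * (k : ℝ) ^ 2)

/-- An arithmetic in which the leaf tests are reliable for entries of modulus between `η` and `X`:
it rounds with error at most `ε` on the range that is needed, and its tolerance lies between the
errors of the residuals and the resolution of the `2 ^ B` phases. -/
structure Regime (ar : Arith) (n k B : ℕ) (ε X η : ℝ) : Prop where
  two_le : 2 ≤ n
  eps_nonneg : 0 ≤ ε
  acc : ∀ r, |r| ≤ 100 * n * X → |ar.rnd r - r| ≤ ε
  one_le_X : 1 ≤ X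
  eta_pos : 0 < η
  eta_le : η ≤ 1
  err_le : 1000 * n * errBound k ε X ≤ ar.tol * η
  tol_le : 16 * ar.tol * 2 ^ B ≤ η

theorem norm_mul_ofReal_of_norm_eq_one {a : ℂ} (ha : ‖a‖ = 1) (v : ℝ) : ‖a * v‖ = |v| := by
  rw [norm_mul, ha, one_mul, Complex.norm_real, Real.norm_eq_abs]

theorem norm_coefI (j : Fin n) : ‖coefI j‖ = 1 := Complex.norm_exp_ofReal_mul_I _

theorem norm_coefV (ω : Design n M d B) (i : Fin M) (j : Fin n) : ‖coefV ω i j‖ = 1 :=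
  Complex.norm_exp_ofReal_mul_I _

namespace Regime

variable {ar : Arith} {ε X η : ℝ} (h : Regime ar n k B ε X η)
include h

theorem two_le_cast : (2 : ℝ) ≤ n := by exact_mod_cast h.two_le

theorem step_nonneg : 0 ≤ 8 * ε * X :=
  mul_nonneg (mul_nonneg (by norm_num) h.eps_nonneg) (zero_le_one.trans h.one_le_X)

theorem step_le_errBound : 8 * ε * X ≤ errBound k ε X :=
  le_mul_of_one_le_right h.step_nonneg (le_add_of_nonneg_right (by positivity))

theorem eps_le_step : 8 * ε ≤ 8 * ε * X :=
  le_mul_of_one_le_right (mul_nonneg (by norm_num) h.eps_nonneg) h.one_le_X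

theorem eps_le_errBound : 8 * ε ≤ errBound k ε X := h.eps_le_step.trans h.step_le_errBound

theorem errBound_nonneg : 0 ≤ errBound k ε X := h.step_nonneg.trans h.step_le_errBound

theorem tol_nonneg : 0 ≤ ar.tol :=
  nonneg_of_mul_nonneg_left
    ((mul_nonneg (by positivity) h.errBound_nonneg).trans h.err_le) h.eta_pos

theorem tol_le_eta : 16 * ar.tol ≤ η :=
  (le_mul_of_one_le_right (mul_nonneg (by norm_num) h.tol_nonneg)
    (one_le_pow₀ one_le_two)).trans h.tol_le

theorem mul_errBound_le_tol : 1000 * (n * errBound k ε X) ≤ ar.tol := by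
  have := mul_le_mul_of_nonneg_left h.eta_le h.tol_nonneg
  linarith [h.err_le]

theorem errBound_le_tol : 2000 * errBound k ε X ≤ ar.tol := by
  have := mul_le_mul_of_nonneg_right h.two_le_cast h.errBound_nonneg
  linarith [h.mul_errBound_le_tol]

theorem errBound_le_one : errBound k ε X ≤ 1 / 1000 := by
  linarith [h.errBound_le_tol, h.tol_le_eta, h.eta_le, h.errBound_nonneg]

theorem eps_le_one : ε ≤ 1 / 8000 := by linarith [h.eps_le_errBound, h.errBound_le_one]

theorem n_le_n_mul : (n : ℝ) ≤ n * X := le_mul_of_one_le_right (Nat.cast_nonneg n) h.one_le_X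

theorem two_mul_le_n_mul : 2 * X ≤ n * X :=
  mul_le_mul_of_nonneg_right h.two_le_cast (zero_le_one.trans h.one_le_X)

theorem norm_rndC_sub_le {z : ℂ} (hz : ‖z‖ ≤ 100 * n * X) : ‖ar.rndC z - z‖ ≤ 2 * ε := by
  refine (Complex.norm_le_abs_re_add_abs_im _).trans ?_
  have hre := h.acc z.re ((Complex.abs_re_le_norm z).trans hz)
  have him := h.acc z.im ((Complex.abs_im_le_norm z).trans hz)
  simp only [Complex.sub_re, Complex.sub_im, Arith.rndC]
  linarith

theorem norm_rndC_sub_le_of_norm_eq_one {a : ℂ} (ha : ‖a‖ = 1) : ‖ar.rndC a - a‖ ≤ 2 * ε :=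
  h.norm_rndC_sub_le (by linarith [h.two_mul_le_n_mul, h.one_le_X])

theorem half_le_norm_rndC {a : ℂ} (ha : ‖a‖ = 1) : 1 / 2 ≤ ‖ar.rndC a‖ := by
  have := norm_le_norm_add_norm_sub (ar.rndC a) a
  linarith [h.norm_rndC_sub_le_of_norm_eq_one ha, h.eps_le_one]

theorem norm_rndC_mul_sub_le {a : ℂ} (ha : ‖a‖ = 1) {v V : ℝ} (hv : |v| ≤ V)
    (hV : V ≤ 40 * n * X) : ‖ar.rndC (ar.rndC a * v) - a * v‖ ≤ 2 * ε * V + 2 * ε := by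
  have hV0 : 0 ≤ V := (abs_nonneg v).trans hv
  have hweight : ‖ar.rndC a * v - a * v‖ ≤ 2 * ε * V := by
    rw [← sub_mul, norm_mul, Complex.norm_real, Real.norm_eq_abs]
    exact mul_le_mul (h.norm_rndC_sub_le_of_norm_eq_one ha) hv (abs_nonneg v)
      (mul_nonneg zero_le_two h.eps_nonneg)
  have hsize : ‖ar.rndC a * v‖ ≤ 100 * n * X := by
    have := norm_le_norm_add_norm_sub' (ar.rndC a * v) (a * v)
    rw [norm_mul_ofReal_of_norm_eq_one ha] at this
    have : 2 * ε * V ≤ 1 * V := mul_le_mul_of_nonneg_right (by linarith [h.eps_le_one]) hV0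
    linarith [h.n_le_n_mul]
  linarith [norm_sub_le_norm_sub_add_norm_sub (ar.rndC (ar.rndC a * v)) (ar.rndC a * v) (a * v),
    h.norm_rndC_sub_le hsize]

theorem abs_entry_sub_le {u : ℂ} {x ρ : ℝ} (j : Fin n) (hu : ‖u - x * coefI j‖ ≤ ρ)
    (hρ : ρ ≤ 1) (hx : |x| ≤ X) : |entry ar u j - x| ≤ 2 * ρ + 8 * ε * X := by
  obtain ⟨b, hb⟩ : ∃ b, ar.rndC (coefI j) = b := ⟨_, rfl⟩
  have hb_sub := hb ▸ h.norm_rndC_sub_le_of_norm_eq_one (norm_coefI j)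
  have hb_norm := hb ▸ h.half_le_norm_rndC (norm_coefI j)
  have hb0 : b ≠ 0 := norm_pos_iff.1 (by linarith)
  have hX := h.one_le_X
  have hεX := mul_nonneg h.eps_nonneg (zero_le_one.trans hX)
  have hquot : ‖u / b - x‖ ≤ 2 * ρ + 4 * ε * X := by
    have hnum : ‖(u - x * coefI j) - x * (b - coefI j)‖ ≤ ρ + X * (2 * ε) := by
      refine (norm_sub_le _ _).trans (add_le_add hu ?_)
      rw [norm_mul, Complex.norm_real, Real.norm_eq_abs]
      exact mul_le_mul hx hb_sub (norm_nonneg _) (by linarith)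
    have heq : u / b - x = ((u - x * coefI j) - x * (b - coefI j)) / b := by
      field_simp
      ring
    rw [heq, norm_div, div_le_iff₀ (by linarith)]
    nlinarith [(norm_nonneg _).trans hu]
  have hsize : ‖u / b‖ ≤ 100 * n * X := by
    have := norm_le_norm_add_norm_sub' (u / b) (x : ℂ)
    rw [Complex.norm_real, Real.norm_eq_abs] at this
    linarith [h.step_le_errBound, h.errBound_le_one, h.two_mul_le_n_mul]
  have hrnd : |entry ar u j - (u / b).re| ≤ ε := by
    rw [entry, hb]
    exact h.acc _ ((Complex.abs_re_le_norm _).trans hsize)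
  have hre := (Complex.abs_re_le_norm (u / b - x)).trans hquot
  rw [Complex.sub_re, Complex.ofReal_re] at hre
  linarith [abs_sub_le (entry ar u j) (u / b).re x, h.eps_le_step, h.eps_nonneg]

theorem abs_entry_le {u : ℂ} (j : Fin n) (hu : ‖u‖ ≤ 2 * n * X) :
    |entry ar u j| ≤ 5 * n * X := by
  have hb := h.half_le_norm_rndC (norm_coefI j)
  have hre : |(u / ar.rndC (coefI j)).re| ≤ 4 * n * X := by
    refine (Complex.abs_re_le_norm _).trans ?_
    rw [norm_div, div_le_iff₀ (by linarith)]
    nlinarith [h.n_le_n_mul, h.two_le_cast]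
  have hrnd : |entry ar u j - (u / ar.rndC (coefI j)).re| ≤ ε :=
    h.acc _ (hre.trans (by linarith [h.n_le_n_mul, h.two_le_cast]))
  linarith [abs_sub_abs_le_abs_sub (entry ar u j) (u / ar.rndC (coefI j)).re, h.eps_le_one,
    h.n_le_n_mul, h.two_le_cast]

theorem norm_reduce_sub_le {a u w : ℂ} {x v ρ : ℝ} (ha : ‖a‖ = 1) (hu : ‖u - w‖ ≤ ρ)
    (hρ : ρ ≤ 1) (hw : ‖w‖ ≤ n * X) (hx : |x| ≤ X) (hv : |v - x| ≤ 1) :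
    ‖reduce ar a v u - (w - x * a)‖ ≤ ρ + (|v - x| + 8 * ε * X) := by
  have hX := h.one_le_X
  have hnX := h.two_mul_le_n_mul
  have hv2 : |v| ≤ 2 * X := by linarith [abs_sub_abs_le_abs_sub v x]
  obtain ⟨p, hp⟩ : ∃ p, ar.rndC (ar.rndC a * v) = p := ⟨_, rfl⟩
  have hpv : ‖p - a * v‖ ≤ 4 * ε * X + 2 * ε := by
    have := hp ▸ h.norm_rndC_mul_sub_le ha hv2 (by linarith)
    linarith
  have hav : ‖a * v‖ ≤ 2 * X := (norm_mul_ofReal_of_norm_eq_one ha v).trans_le hv2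
  have hsize : ‖u - p‖ ≤ 100 * n * X := by
    have hu_norm := norm_le_norm_add_norm_sub' u w
    have hp_norm := norm_le_norm_add_norm_sub' p (a * v)
    linarith [norm_sub_le u p, h.step_le_errBound, h.errBound_le_one, h.eps_le_one]
  have hrnd := h.norm_rndC_sub_le hsize
  have hsplit : reduce ar a v u - (w - x * a) =
      (ar.rndC (u - p) - (u - p)) + (u - w) - (p - a * v) - a * ((v - x : ℝ) : ℂ) := by
    rw [reduce, hp]
    push_cast
    ring
  have hlast := norm_sub_le ((ar.rndC (u - p) - (u - p)) + (u - w) - (p - a * v))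
    (a * ((v - x : ℝ) : ℂ))
  rw [← hsplit, norm_mul_ofReal_of_norm_eq_one ha] at hlast
  linarith [norm_sub_le ((ar.rndC (u - p) - (u - p)) + (u - w)) (p - a * v),
    norm_add_le (ar.rndC (u - p) - (u - p)) (u - w), h.eps_le_step]

theorem abs_discrepancy_sub_le {a w : ℂ} {v V : ℝ} (ha : ‖a‖ = 1) (hv : |v| ≤ V)
    (hV : V ≤ 5 * n * X) (hw : ‖w‖ ≤ 2 * n * X) :
    |discrepancy ar a v w - ‖a * v - w‖| ≤ 2 * ε * V + 5 * ε := by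
  have hn := h.two_le_cast
  have hnX := h.n_le_n_mul
  have hV0 : 0 ≤ V := (abs_nonneg v).trans hv
  obtain ⟨p, hp⟩ : ∃ p, ar.rndC (ar.rndC a * v) = p := ⟨_, rfl⟩
  have hpv := hp ▸ h.norm_rndC_mul_sub_le ha hv (by linarith)
  have hεV : 2 * ε * V ≤ 1 * V := mul_le_mul_of_nonneg_right (by linarith [h.eps_le_one]) hV0
  have hε := h.eps_le_one
  have hsize : ‖p - w‖ ≤ 50 * n * X := by
    have := norm_le_norm_add_norm_sub' p (a * v)
    rw [norm_mul_ofReal_of_norm_eq_one ha] at this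
    linarith [norm_sub_le p w]
  have hrndC := h.norm_rndC_sub_le (hsize.trans (by linarith))
  have hrnd : |discrepancy ar a v w - ‖ar.rndC (p - w)‖| ≤ ε := by
    rw [discrepancy, hp]
    refine h.acc _ ?_
    rw [abs_norm]
    linarith [norm_le_norm_add_norm_sub' (ar.rndC (p - w)) (p - w)]
  have hdiff : |‖ar.rndC (p - w)‖ - ‖a * v - w‖| ≤ 2 * ε + (2 * ε * V + 2 * ε) := by
    refine (abs_norm_sub_norm_le _ _).trans ?_
    have := norm_sub_le_norm_sub_add_norm_sub (ar.rndC (p - w)) (p - w) (a * v - w)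
    rw [sub_sub_sub_cancel_right] at this
    linarith
  linarith [abs_sub_le (discrepancy ar a v w) ‖ar.rndC (p - w)‖ ‖a * v - w‖]

theorem discrepancy_le {a w : ℂ} {x v : ℝ} (ha : ‖a‖ = 1) (hx : |x| ≤ X)
    (hw : ‖w - x * a‖ ≤ errBound k ε X) (hv : |v - x| ≤ 3 * errBound k ε X) :
    discrepancy ar a v w ≤ ar.tol := by
  have hX := h.one_le_X
  have hnX := h.two_mul_le_n_mul
  have hE := h.errBound_le_one
  have hv2 : |v| ≤ 2 * X := by linarith [abs_sub_abs_le_abs_sub v x]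
  have hxa : ‖(x : ℂ) * a‖ = |x| := by rw [mul_comm, norm_mul_ofReal_of_norm_eq_one ha]
  have hw2 : ‖w‖ ≤ 2 * n * X := by
    have := norm_le_norm_add_norm_sub' w (x * a)
    linarith
  have hdist : ‖a * v - w‖ ≤ 4 * errBound k ε X := by
    have hsplit : a * v - w = a * ((v - x : ℝ) : ℂ) - (w - x * a) := by push_cast; ring
    have := norm_sub_le (a * ((v - x : ℝ) : ℂ)) (w - x * a)
    rw [← hsplit, norm_mul_ofReal_of_norm_eq_one ha] at this
    linarith
  have hd := (abs_le.1 (h.abs_discrepancy_sub_le ha hv2 (by linarith) hw2)).2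
  linarith [h.step_le_errBound, h.eps_le_errBound, h.errBound_le_tol, h.errBound_nonneg]

theorem norm_le_of_discrepancy_le {a w z : ℂ} {v : ℝ} (ha : ‖a‖ = 1) (hv : |v| ≤ 5 * n * X)
    (hw : ‖w - z‖ ≤ errBound k ε X) (hz : ‖z‖ ≤ n * X) (hd : discrepancy ar a v w ≤ ar.tol) :
    ‖a * v - z‖ ≤ 2 * ar.tol := by
  have hE := h.errBound_le_one
  have hw2 : ‖w‖ ≤ 2 * n * X := by
    linarith [norm_le_norm_add_norm_sub' w z, h.n_le_n_mul, h.two_le_cast]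
  have hrnd := (abs_le.1 (h.abs_discrepancy_sub_le ha hv le_rfl hw2)).1
  have hnε := mul_le_mul_of_nonneg_left h.step_le_errBound (Nat.cast_nonneg (α := ℝ) n)
  linarith [norm_sub_le_norm_sub_add_norm_sub (a * v) w z, h.mul_errBound_le_tol,
    h.errBound_le_tol, h.eps_le_errBound, h.errBound_nonneg, h.tol_nonneg]

theorem candidate_eq_none {N : Fin n → Finset (Fin M)} {u : ℂ} (i : Fin M)
    (hu : ‖u‖ ≤ errBound k ε X) : candidate ar N u i = none := by
  have hE := h.errBound_le_one
  have hrnd := h.acc ‖u‖ (by rw [abs_norm]; linarith [h.n_le_n_mul, h.two_le_cast])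
  refine if_pos ?_
  linarith [(abs_le.1 hrnd).2, h.eps_le_errBound, h.errBound_le_tol, h.errBound_nonneg]

end Regime

theorem toNode_add_one (j : Fin n) : toNode n ((j : ℤ) + 1) = some j := by
  have hj : (1 : ℤ) ≤ (j : ℤ) + 1 ∧ ((j : ℤ) + 1 : ℤ) ≤ n := by have := j.2; omega
  rw [toNode, dif_pos hj]
  simp

theorem abs_arg_sub_le {u : ℂ} {r θ τ : ℝ} (hr : 0 < r)
    (hu : ‖u - r * Complex.exp (θ * Complex.I)‖ ≤ τ * r) (hτ : τ ≤ 1 / 2)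
    (hlow : -π < θ - 3 / 2 * τ) (hhigh : θ + 3 / 2 * τ ≤ π) : |u.arg - θ| ≤ 3 / 2 * τ := by
  set a := Complex.exp (θ * Complex.I) with ha
  have hnorm : ‖a‖ = 1 := Complex.norm_exp_ofReal_mul_I _
  have ha0 : a ≠ 0 := Complex.exp_ne_zero _
  have hr0 : (r : ℂ) ≠ 0 := by exact_mod_cast hr.ne'
  obtain ⟨z, hz⟩ : ∃ z, (u - r * a) / (r * a) = z := ⟨_, rfl⟩
  have hz_norm : ‖z‖ ≤ τ := by
    rwa [← hz, norm_div, norm_mul, hnorm, mul_one, Complex.norm_real, Real.norm_of_nonneg hr.le,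
      div_le_iff₀ hr]
  have hu_eq : u = r * (a * (1 + z)) := by
    rw [← hz]
    field_simp
    ring
  have hargz : |(1 + z).arg| ≤ 3 / 2 * τ := by
    rw [← Complex.log_im]
    exact (Complex.abs_im_le_norm _).trans
      ((Complex.norm_log_one_add_half_le_self (hz_norm.trans hτ)).trans (by linarith))
  have hz1 : 1 + z ≠ 0 := fun h0 => by
    rw [show z = -1 by linear_combination h0, norm_neg, norm_one] at hz_norm
    linarith
  have hτ0 : 0 ≤ τ := (norm_nonneg _).trans hz_norm
  have harga : a.arg = θ := by
    rw [ha, Complex.arg_exp_mul_I, toIocMod_eq_self]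
    constructor <;> linarith
  rw [abs_le] at hargz
  have hmem : a.arg + (1 + z).arg ∈ Set.Ioc (-π) π := by
    rw [harga]
    constructor <;> linarith
  rw [hu_eq, Complex.arg_real_mul _ hr, Complex.arg_mul ha0 hz1 hmem, harga,
    add_sub_cancel_left, abs_le]
  exact hargz

namespace Regime

variable {ar : Arith} {ε X η : ℝ} (h : Regime ar n k B ε X η)
include h

theorem acc_of_abs_le {r : ℝ} (hr : |r| ≤ 50 * n) : |ar.rnd r - r| ≤ ε :=
  h.acc r (hr.trans (by linarith [h.n_le_n_mul, h.two_le_cast]))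

theorem abs_phaseModPi_sub_le {u : ℂ} {x θ τ : ℝ} (hx : x ≠ 0)
    (hu : ‖u - x * Complex.exp (θ * Complex.I)‖ ≤ τ * |x|) (hτ : 100 * τ ≤ θ) (hε : 8 * ε ≤ τ)
    (hτ1 : τ ≤ 1 / 2) (hθ0 : 0 < θ) (hθ : θ ≤ π / 2) : |phaseModPi ar u - θ| ≤ 2 * τ := by
  have hπ3 := Real.pi_gt_three
  have hπ4 := Real.pi_le_four
  have hn := h.two_le_cast
  have hε0 := h.eps_nonneg
  have harg := abs_le.1 (h.acc_of_abs_le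
    ((Complex.abs_arg_le_pi u).trans (by linarith : π ≤ 50 * (n : ℝ))))
  have hrndpi := abs_le.1 (h.acc_of_abs_le
    ((abs_of_pos Real.pi_pos).trans_le (by linarith : π ≤ 50 * (n : ℝ))))
  rw [phaseModPi]
  rcases lt_or_gt_of_ne hx with hneg | hpos
  · have hflip : ((|x| : ℝ) : ℂ) * Complex.exp ((θ - π : ℝ) * Complex.I) =
        x * Complex.exp (θ * Complex.I) := by
      rw [abs_of_neg hneg]
      push_cast
      rw [sub_mul, Complex.exp_sub, Complex.exp_pi_mul_I]
      ring
    have hu_arg := abs_le.1 (abs_arg_sub_le (abs_pos.2 hx) (hflip.symm ▸ hu) hτ1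
      (by linarith) (by linarith))
    have hsum := abs_le.1 (h.acc_of_abs_le (r := ar.rnd u.arg + ar.rnd π)
      (by rw [abs_le]; constructor <;> linarith [hu_arg.1, hu_arg.2, harg.1, harg.2, hrndpi.1,
        hrndpi.2]))
    rw [if_pos (by linarith [hu_arg.2, harg.2]), abs_le]
    constructor <;> linarith [hu_arg.1, hu_arg.2, harg.1, harg.2, hrndpi.1, hrndpi.2, hsum.1,
      hsum.2]
  · rw [abs_of_pos hpos] at hu
    have hu_arg := abs_le.1 (abs_arg_sub_le hpos hu hτ1 (by linarith) (by linarith))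
    rw [if_neg (by linarith [hu_arg.1, harg.1]), abs_le]
    constructor <;> linarith [hu_arg.1, hu_arg.2, harg.1, harg.2]

theorem abs_phaseIndex_sub_le {u : ℂ} {q τ : ℝ} (hq : |phaseModPi ar u - q * π / (2 * n)| ≤ 2 * τ)
    (hq0 : 0 ≤ q) (hqn : q ≤ n) (hτ : 100 * (n * τ) ≤ 1) (hε : 8 * ε ≤ τ) :
    |phaseIndex ar n u - q| ≤ 5 * (n * τ) := by
  have hπ3 := Real.pi_gt_three
  have hπ4 := Real.pi_le_four
  have hn := h.two_le_cast
  have hτ0 : 0 ≤ τ := (mul_nonneg (by norm_num) h.eps_nonneg).trans hε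
  have hscale : 2 * (n : ℝ) / π ≤ n := by
    rw [div_le_iff₀ Real.pi_pos]
    nlinarith
  obtain ⟨γ, hγ⟩ : ∃ γ, ar.rnd (2 * n / π) = γ := ⟨_, rfl⟩
  have hγ_sub : |γ - 2 * n / π| ≤ ε :=
    hγ ▸ h.acc_of_abs_le (by rw [abs_of_nonneg (by positivity)]; linarith)
  have hγ_abs : |γ| ≤ 3 / 2 * n := by
    have := h.eps_le_one
    rw [abs_le] at hγ_sub ⊢
    constructor <;> linarith [hγ_sub.1, hγ_sub.2, show 0 ≤ 2 * (n : ℝ) / π by positivity]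
  have hθ0 : 0 ≤ q * π / (2 * n) := by positivity
  have hθ2 : q * π / (2 * n) ≤ 2 := by
    rw [div_le_iff₀ (by positivity)]
    nlinarith
  have hprod : |phaseModPi ar u * γ - q| ≤ 3 * (n * τ) + 2 * ε := by
    have hsplit : phaseModPi ar u * γ - q =
        (phaseModPi ar u - q * π / (2 * n)) * γ + q * π / (2 * n) * (γ - 2 * n / π) := by
      have : q * π / (2 * n) * (2 * n / π) = q := by field_simp
      linear_combination this
    rw [hsplit]
    refine (abs_add_le _ _).trans ?_
    rw [abs_mul, abs_mul, abs_of_nonneg hθ0]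
    have := mul_le_mul hq hγ_abs (abs_nonneg _) (by linarith)
    have := mul_le_mul hθ2 hγ_sub (abs_nonneg _) zero_le_two
    linarith
  have hτn : 2 * τ ≤ n * τ := mul_le_mul_of_nonneg_right hn hτ0
  have hrnd : |phaseIndex ar n u - phaseModPi ar u * γ| ≤ ε := by
    rw [phaseIndex, hγ]
    refine h.acc_of_abs_le ?_
    rw [abs_le] at hprod ⊢
    constructor <;> linarith [hprod.1, hprod.2]
  linarith [abs_sub_le (phaseIndex ar n u) (phaseModPi ar u * γ) q]

theorem candidate_eq_some_of_abs_sub_le {N : Fin n → Finset (Fin M)} {u : ℂ} {i : Fin M}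
    {j : Fin n} (hij : i ∈ N j) (hu : ¬ ar.rnd ‖u‖ ≤ ar.tol)
    (hj : |phaseIndex ar n u - ((j : ℕ) + 1)| ≤ ar.tol / 2) : candidate ar N u i = some j := by
  have htol : ar.tol ≤ 1 / 16 := by linarith [h.tol_le_eta, h.eta_le]
  have hround : round (phaseIndex ar n u) = (j : ℤ) + 1 := by
    rw [round_eq, Int.floor_eq_iff]
    push_cast
    rw [abs_le] at hj
    constructor <;> linarith [hj.1, hj.2]
  have hfrac : ar.rnd |phaseIndex ar n u - round (phaseIndex ar n u)| ≤ ar.tol := by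
    rw [hround]
    push_cast
    have hrnd := h.acc_of_abs_le (r := |phaseIndex ar n u - ((j : ℕ) + 1)|)
      (by rw [abs_abs]; linarith [h.two_le_cast])
    linarith [(abs_le.1 hrnd).2, h.eps_le_errBound, h.errBound_le_tol, h.eps_nonneg]
  rw [candidate, if_neg hu, if_pos hfrac, hround, toNode_add_one]
  simpa using hij

theorem candidate_eq_some {N : Fin n → Finset (Fin M)} {u : ℂ} {i : Fin M} {j : Fin n} {x : ℝ}
    (hij : i ∈ N j) (hu : ‖u - x * coefI j‖ ≤ errBound k ε X) (hxη : η ≤ |x|) (hxX : |x| ≤ X) :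
    candidate ar N u i = some j := by
  have hη := h.eta_pos
  have htol := h.tol_le_eta
  have hη1 := h.eta_le
  have hn := h.two_le_cast
  have : (0 : ℝ) < n := by linarith
  have hnonzero : ¬ ar.rnd ‖u‖ ≤ ar.tol := by
    have hdist := abs_le.1 ((abs_norm_sub_norm_le u (x * coefI j)).trans hu)
    rw [mul_comm, norm_mul_ofReal_of_norm_eq_one (norm_coefI j)] at hdist
    have hrnd := h.acc ‖u‖ (by
      rw [abs_norm]; linarith [hdist.2, h.two_mul_le_n_mul, h.errBound_le_one, h.one_le_X])
    linarith [(abs_le.1 hrnd).1, hdist.1, h.eps_le_errBound, h.errBound_le_tol, h.tol_nonneg]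
  obtain ⟨τ, hτ⟩ : ∃ τ, ar.tol / (1000 * n) = τ := ⟨_, rfl⟩
  have hnτ : 1000 * (n * τ) = ar.tol := by rw [← hτ]; field_simp
  have hτ0 : 0 ≤ τ := hτ ▸ div_nonneg h.tol_nonneg (by positivity)
  have hEτ : errBound k ε X ≤ τ * η := by
    rw [← hτ, div_mul_eq_mul_div, le_div_iff₀ (by positivity)]
    linarith [h.err_le]
  have hε : 8 * ε ≤ τ :=
    (h.eps_le_errBound.trans hEτ).trans (mul_le_of_le_one_right hτ0 hη1)
  have hθ_low : 100 * τ < ((j : ℕ) + 1 : ℝ) * π / (2 * n) := by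
    rw [lt_div_iff₀ (by positivity)]
    nlinarith [Real.pi_gt_three, (Nat.cast_nonneg j : (0 : ℝ) ≤ (j : ℕ))]
  have hjn : ((j : ℕ) + 1 : ℝ) ≤ n := by exact_mod_cast j.2
  have hθ_high : ((j : ℕ) + 1 : ℝ) * π / (2 * n) ≤ π / 2 := by
    rw [div_le_div_iff₀ (by positivity) two_pos]
    nlinarith [Real.pi_pos]
  have hphase := h.abs_phaseModPi_sub_le (abs_pos.1 (hη.trans_le hxη))
    (hu.trans (hEτ.trans (mul_le_mul_of_nonneg_left hxη hτ0))) hθ_low.le hε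
    (by linarith [mul_le_mul_of_nonneg_right hn hτ0]) (by linarith) hθ_high
  have hindex := h.abs_phaseIndex_sub_le hphase (by positivity) hjn (by linarith) hε
  exact h.candidate_eq_some_of_abs_sub_le hij hnonzero (by linarith [h.tol_nonneg])

end Regime

/-! ## Verification phases -/

/-- The unit complex numbers from which the verification weights are drawn. -/
noncomputable def phase (B : ℕ) (t : Fin (2 ^ B)) : ℂ :=
  Complex.exp ((((t : ℕ) : ℝ) / 2 ^ B * (π / 2) : ℝ) * Complex.I)

theorem norm_exp_sub_exp_ge {α β : ℝ} (hαβ : α ≤ β) (hβ : β - α ≤ π) :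
    2 / π * (β - α) ≤ ‖Complex.exp (β * Complex.I) - Complex.exp (α * Complex.I)‖ := by
  have hfactor : Complex.exp (β * Complex.I) - Complex.exp (α * Complex.I) =
      Complex.exp (α * Complex.I) * (Complex.exp (Complex.I * ((β - α : ℝ) : ℂ)) - 1) := by
    rw [mul_sub, ← Complex.exp_add, mul_one]
    push_cast
    ring_nf
  have hsin := Real.mul_le_sin (x := (β - α) / 2) (by linarith) (by linarith)
  rw [hfactor, norm_mul, Complex.norm_exp_ofReal_mul_I, one_mul,
    Complex.norm_exp_I_mul_ofReal_sub_one, Real.norm_eq_abs]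
  linarith [le_abs_self (2 * Real.sin ((β - α) / 2))]

theorem inv_two_pow_le_norm_phase_sub_of_lt {s t : Fin (2 ^ B)} (hst : s < t) :
    1 / 2 ^ B ≤ ‖phase B t - phase B s‖ := by
  have hst' : ((s : ℕ) : ℝ) + 1 ≤ ((t : ℕ) : ℝ) := by exact_mod_cast hst
  have ht : ((t : ℕ) : ℝ) ≤ 2 ^ B := by exact_mod_cast t.2.le
  have hdiff : ((t : ℕ) : ℝ) / 2 ^ B * (π / 2) - ((s : ℕ) : ℝ) / 2 ^ B * (π / 2) =
      (((t : ℕ) : ℝ) - (s : ℕ)) / 2 ^ B * (π / 2) := by ring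
  have hlow : 1 / 2 ^ B ≤ (((t : ℕ) : ℝ) - (s : ℕ)) / 2 ^ B :=
    div_le_div_of_nonneg_right (by linarith) (by positivity)
  have hhigh : (((t : ℕ) : ℝ) - (s : ℕ)) / 2 ^ B ≤ 1 := by
    rw [div_le_one (by positivity)]
    linarith [(Nat.cast_nonneg s : (0 : ℝ) ≤ (s : ℕ))]
  have hchord := norm_exp_sub_exp_ge (α := ((s : ℕ) : ℝ) / 2 ^ B * (π / 2))
    (β := ((t : ℕ) : ℝ) / 2 ^ B * (π / 2)) (by gcongr; exact hst.le)
    (by rw [hdiff]; nlinarith [Real.pi_pos])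
  rw [hdiff, mul_left_comm, div_mul_div_cancel₀ Real.pi_ne_zero, div_self two_ne_zero,
    mul_one] at hchord
  exact hlow.trans hchord

theorem inv_two_pow_le_norm_phase_sub {s t : Fin (2 ^ B)} (hst : s ≠ t) :
    1 / 2 ^ B ≤ ‖phase B t - phase B s‖ := by
  rcases lt_or_gt_of_ne hst with hlt | hgt
  · exact inv_two_pow_le_norm_phase_sub_of_lt hlt
  · exact norm_sub_rev (phase B s) _ ▸ inv_two_pow_le_norm_phase_sub_of_lt hgt

theorem prob_norm_sub_mul_phase_le (z : ℂ) {x r : ℝ} (hr : 2 * r * 2 ^ B < |x|) :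
    prob {t : Fin (2 ^ B) | ‖z - x * phase B t‖ ≤ r} ≤ 1 / 2 ^ B := by
  have hsub : {t : Fin (2 ^ B) | ‖z - x * phase B t‖ ≤ r}.Subsingleton := by
    intro s hs t ht
    by_contra hne
    have hsplit : (x : ℂ) * (phase B t - phase B s) =
        (z - x * phase B s) - (z - x * phase B t) := by ring
    have hclose := (norm_sub_le _ _).trans (add_le_add hs ht)
    rw [← hsplit, norm_mul, Complex.norm_real, Real.norm_eq_abs] at hclose
    have hfar := (mul_le_mul_of_nonneg_left (inv_two_pow_le_norm_phase_sub hne)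
      (abs_nonneg x)).trans hclose
    rw [mul_one_div, div_le_iff₀ (by positivity)] at hfar
    linarith
  have hcard := Set.ncard_le_one_iff_subsingleton.2 hsub
  rw [prob, Fintype.card_fin]
  push_cast
  exact div_le_div_of_nonneg_right (by exact_mod_cast hcard) (by positivity)

theorem prob_norm_sub_sum_phase_le {V : Type} [Fintype V] [DecidableEq V] {η r : ℝ}
    (hr : 2 * r * 2 ^ B < η) {S : Finset V} (hS : 2 ≤ S.card) {x : V → ℝ}
    (hx : ∀ j ∈ S, η ≤ |x j|) (j₀ : V) (v : ℝ) :
    prob {θ : V → Fin (2 ^ B) |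
      ‖phase B (θ j₀) * v - ∑ j ∈ S, x j * phase B (θ j)‖ ≤ r} ≤ 1 / 2 ^ B := by
  obtain ⟨j₁, hj₁, hne⟩ := Finset.exists_mem_ne (s := S) (by omega) j₀
  refine prob_le_of_forall_update j₁ (by positivity) fun θ => ?_
  have hrest : ∀ t, ∑ j ∈ S, x j * phase B (Function.update θ j₁ t j) =
      x j₁ * phase B t + ∑ j ∈ S.erase j₁, x j * phase B (θ j) := fun t => by
    rw [← Finset.add_sum_erase S _ hj₁, Function.update_self]
    exact congrArg _ (Finset.sum_congr rfl fun j hj => by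
      rw [Function.update_of_ne (Finset.ne_of_mem_erase hj)])
  refine le_of_eq_of_le (congrArg prob (Set.ext fun t => ?_)) (prob_norm_sub_mul_phase_le
    (phase B (θ j₀) * v - ∑ j ∈ S.erase j₁, x j * phase B (θ j)) (hr.trans_le (hx j₁ hj₁)))
  rw [Set.mem_ofPred_eq, Set.mem_ofPred_eq, Set.mem_ofPred_eq, hrest,
    Function.update_of_ne hne.symm, sub_sub, add_comm]

/-! ## Peeling with known leaves -/

/-- Sum of the contributions of the entries of `x` in `S` to the right node `i`, with weights `a`,
in a graph with neighbourhoods `N`. -/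
noncomputable def contrib (N : Fin n → Finset (Fin M)) (x : Fin n → ℝ) (S : Finset (Fin n))
    (a : Fin n → ℂ) (i : Fin M) : ℂ :=
  ∑ j ∈ S.filter (i ∈ N ·), x j * a j

/-- Bound for the error of the residual at `i` due to the decoded entries `D`, where `δ` is the
rounding error of a subtraction. -/
noncomputable def drift (N : Fin n → Finset (Fin M)) (x xhat : Fin n → ℝ) (D : Finset (Fin n))
    (δ : ℝ) (i : Fin M) : ℝ :=
  ∑ j ∈ D.filter (i ∈ N ·), (|xhat j - x j| + δ)

/-- The part of the memory of the decoder that does not depend on the phases, together with the set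
of the entries that are not yet decoded. -/
structure PeelState (n M : ℕ) where
  resI : Fin M → ℂ
  xhat : Fin n → ℝ
  rest : Finset (Fin n)

/-- The state after the measurements of a signal `x` with support `S₀` have been read. -/
noncomputable def PeelState.init (ar : Arith) (N : Fin n → Finset (Fin M)) (x : Fin n → ℝ)
    (S₀ : Finset (Fin n)) : PeelState n M :=
  ⟨fun i => ar.rndC (contrib N x S₀ coefI i), 0, S₀⟩

/-- The state after the left node `j` has been decoded with value `v`. -/
noncomputable def PeelState.decodeNode (ar : Arith) (N : Fin n → Finset (Fin M)) (j : Fin n) (v : ℝ)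
    (st : PeelState n M) : PeelState n M :=
  ⟨fun i => if i ∈ N j then reduce ar (coefI j) v (st.resI i) else st.resI i,
    Function.update st.xhat j v, st.rest.erase j⟩

/-- Peeling iteration number `t` of a decoder that is told which right nodes are leaves and
therefore needs no verification. -/
noncomputable def PeelState.next (ar : Arith) (N : Fin n → Finset (Fin M))
    (pick : ℕ → Finset (Fin M) → Fin M) (t : ℕ) (st : PeelState n M) : PeelState n M :=
  if leaves N st.rest = ∅ then st else
    let i := pick t (leaves N st.rest)
    (candidate ar N (st.resI i) i).elim st fun j =>
      st.decodeNode ar N j (entry ar (st.resI i) j)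

/-- The state after `t` iterations of the decoder that is told the leaves. It is a function of the
graph alone, hence independent of the phases. -/
noncomputable def PeelState.run (ar : Arith) (N : Fin n → Finset (Fin M))
    (pick : ℕ → Finset (Fin M) → Fin M) (st : PeelState n M) : ℕ → PeelState n M
  | 0 => st
  | t + 1 => (PeelState.run ar N pick st t).next ar N pick t

/-- The residuals `u` approximate, up to the drift, the contributions with weights `a` of the
entries that are not yet decoded in the state `st`. -/
def PeelState.IsResidual (N : Fin n → Finset (Fin M)) (x : Fin n → ℝ) (S₀ : Finset (Fin n)) (δ : ℝ)
    (st : PeelState n M) (a : Fin M → Fin n → ℂ) (u : Fin M → ℂ) : Prop :=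
  ∀ i, ‖u i - contrib N x st.rest (a i) i‖ ≤ δ + drift N x st.xhat (S₀ \ st.rest) δ i

/-- The state `st` is as accurate as the number of walks through the decoded entries allows. -/
structure PeelState.Sound (N : Fin n → Finset (Fin M)) (x : Fin n → ℝ) (S₀ : Finset (Fin n))
    (δ : ℝ) (st : PeelState n M) : Prop where
  rest_subset : st.rest ⊆ S₀
  xhat_eq_zero : ∀ j ∉ S₀ \ st.rest, st.xhat j = 0
  err_le : ∀ j ∈ S₀ \ st.rest, |st.xhat j - x j| + δ ≤
    4 * δ * walks N (S₀ \ st.rest).card ((S₀ \ st.rest).erase j) j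
  isResidual : st.IsResidual N x S₀ δ (fun _ => coefI) st.resI

/-- A signal `x` with support `S₀` and neighbourhoods `N` for which peeling succeeds. -/
structure Peels (N : Fin n → Finset (Fin M)) (k : ℕ) (x : Fin n → ℝ) (X η : ℝ)
    (S₀ : Finset (Fin n)) : Prop where
  mem_iff : ∀ j, j ∈ S₀ ↔ x j ≠ 0
  card_le : S₀.card ≤ k
  eta_le : ∀ j ∈ S₀, η ≤ |x j|
  le_X : ∀ j, |x j| ≤ X
  not_manyWalks : ¬ ManyWalks N k S₀
  not_leafless : ¬ Leafless N S₀

section Contributions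

variable {N : Fin n → Finset (Fin M)} {x xhat : Fin n → ℝ} {i : Fin M} {j : Fin n}

theorem norm_contrib_le {X : ℝ} (hX : 0 ≤ X) (hx : ∀ j, |x j| ≤ X) (S : Finset (Fin n))
    {a : Fin n → ℂ} (ha : ∀ j, ‖a j‖ = 1) (i : Fin M) : ‖contrib N x S a i‖ ≤ n * X := by
  calc ‖contrib N x S a i‖ ≤ ∑ j ∈ S.filter (i ∈ N ·), ‖x j * a j‖ := norm_sum_le _ _
    _ ≤ ∑ _ ∈ S.filter (i ∈ N ·), X := Finset.sum_le_sum fun _ _ => by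
        rw [mul_comm, norm_mul_ofReal_of_norm_eq_one (ha _)]
        exact hx _
    _ = (S.filter (i ∈ N ·)).card * X := by rw [Finset.sum_const, nsmul_eq_mul]
    _ ≤ n * X := by
        gcongr
        exact (Finset.card_le_univ _).trans_eq (Fintype.card_fin n)

theorem contrib_eq_of_filter_eq_singleton {S : Finset (Fin n)} {a : Fin n → ℂ}
    (hS : S.filter (i ∈ N ·) = {j}) : contrib N x S a i = x j * a j := by
  rw [contrib, hS, Finset.sum_singleton]

theorem contrib_erase {R : Finset (Fin n)} (hj : j ∈ R) (a : Fin n → ℂ) :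
    contrib N x (R.erase j) a i = contrib N x R a i - if i ∈ N j then x j * a j else 0 := by
  simp only [contrib, Finset.sum_filter, ← Finset.add_sum_erase R _ hj, add_sub_cancel_left]

theorem drift_update_insert {D : Finset (Fin n)} (hj : j ∉ D) (v δ : ℝ) :
    drift N x (Function.update xhat j v) (insert j D) δ i =
      (if i ∈ N j then |v - x j| + δ else 0) + drift N x xhat D δ i := by
  simp only [drift, Finset.sum_filter]
  rw [Finset.sum_insert hj, Function.update_self]
  exact congrArg _ (Finset.sum_congr rfl fun j' hj' => by
    rw [Function.update_of_ne (ne_of_mem_of_not_mem hj' hj)])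

theorem add_drift_le_walks {D : Finset (Fin n)} {δ : ℝ} (hδ : 0 ≤ δ)
    (herr : ∀ j' ∈ D, |xhat j' - x j'| + δ ≤ 4 * δ * walks N D.card (D.erase j') j')
    (hij : i ∈ N j) :
    4 * δ + 2 * drift N x xhat D δ i ≤ 4 * δ * walks N (D.card + 1) D j := by
  have hdrift : drift N x xhat D δ i ≤ ∑ j' ∈ D, 4 * δ *
      (if ¬ Disjoint (N j) (N j') then walks N D.card (D.erase j') j' else 0) := by
    rw [drift, Finset.sum_filter]
    refine Finset.sum_le_sum fun j' hj' => ?_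
    by_cases hij' : i ∈ N j'
    · rw [if_pos hij', if_pos (Finset.not_disjoint_iff.2 ⟨i, hij, hij'⟩)]
      exact herr j' hj'
    · rw [if_neg hij']
      refine mul_nonneg (by positivity) ?_
      split_ifs
      exacts [le_rfl, walks_nonneg N _ _ _]
  rw [← Finset.mul_sum] at hdrift
  rw [walks]
  linarith

end Contributions

section Runs

variable {ar : Arith} {ε X η : ℝ} {N : Fin n → Finset (Fin M)} {x : Fin n → ℝ}
  {S₀ : Finset (Fin n)} {st : PeelState n M}

theorem Peels.norm_contrib_le (h : Regime ar n k B ε X η) (hp : Peels N k x X η S₀)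
    (S : Finset (Fin n)) {a : Fin n → ℂ} (ha : ∀ j, ‖a j‖ = 1) (i : Fin M) :
    ‖contrib N x S a i‖ ≤ n * X :=
  SHOFA.norm_contrib_le (zero_le_one.trans h.one_le_X) hp.le_X S ha i

theorem PeelState.IsResidual.decodeNode (h : Regime ar n k B ε X η) (hp : Peels N k x X η S₀)
    (hst : st.rest ⊆ S₀)
    (hdrift : ∀ i, 8 * ε * X + drift N x st.xhat (S₀ \ st.rest) (8 * ε * X) i ≤ 1)
    {a : Fin M → Fin n → ℂ} (ha : ∀ i j, ‖a i j‖ = 1) {u : Fin M → ℂ}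
    (hu : st.IsResidual N x S₀ (8 * ε * X) a u) {j : Fin n} (hj : j ∈ st.rest) {v : ℝ}
    (hv : |v - x j| ≤ 1) :
    (st.decodeNode ar N j v).IsResidual N x S₀ (8 * ε * X) a
      fun i => if i ∈ N j then reduce ar (a i j) v (u i) else u i := by
  intro i
  simp only [PeelState.decodeNode]
  rw [Finset.sdiff_erase (hst hj), contrib_erase hj,
    drift_update_insert (fun hjD => (Finset.mem_sdiff.1 hjD).2 hj)]
  by_cases hij : i ∈ N j
  · simp only [if_pos hij]
    linarith [h.norm_reduce_sub_le (ha i j) (hu i) (hdrift i)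
      (hp.norm_contrib_le h st.rest (ha i) i) (hp.le_X j) hv]
  · simp only [if_neg hij, sub_zero, zero_add]
    exact hu i

theorem Regime.step_add_sum_walks_le {V W : Type} [DecidableEq V] [DecidableEq W]
    (h : Regime ar n k B ε X η) {N : V → Finset W} {S₀ : Finset V}
    (hN : ¬ ManyWalks N k S₀) :
    8 * ε * X + ∑ j ∈ S₀, 4 * (8 * ε * X) * walks N k (S₀.erase j) j ≤ errBound k ε X := by
  rw [← Finset.mul_sum, errBound]
  have := mul_le_mul_of_nonneg_left (not_lt.1 hN) (mul_nonneg (by norm_num : (0 : ℝ) ≤ 4)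
    h.step_nonneg)
  linarith

theorem PeelState.Sound.err_le_walks {δ : ℝ} (hs : st.Sound N x S₀ δ) (hδ : 0 ≤ δ)
    (hS₀ : S₀.card ≤ k) {j : Fin n} (hj : j ∈ S₀ \ st.rest) :
    |st.xhat j - x j| + δ ≤ 4 * δ * walks N k (S₀.erase j) j :=
  (hs.err_le j hj).trans (mul_le_mul_of_nonneg_left
    (walks_mono N ((Finset.card_le_card Finset.sdiff_subset).trans hS₀)
      (Finset.erase_subset_erase _ Finset.sdiff_subset) j) (by positivity))

theorem PeelState.Sound.drift_le_errBound (h : Regime ar n k B ε X η) (hp : Peels N k x X η S₀)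
    (hs : st.Sound N x S₀ (8 * ε * X)) (i : Fin M) :
    8 * ε * X + drift N x st.xhat (S₀ \ st.rest) (8 * ε * X) i ≤ errBound k ε X := by
  refine le_trans ?_ (h.step_add_sum_walks_le hp.not_manyWalks)
  gcongr
  calc drift N x st.xhat (S₀ \ st.rest) (8 * ε * X) i
    _ ≤ ∑ j ∈ (S₀ \ st.rest).filter (i ∈ N ·), 4 * (8 * ε * X) * walks N k (S₀.erase j) j :=
        Finset.sum_le_sum fun j hj =>
          hs.err_le_walks h.step_nonneg hp.card_le (Finset.mem_filter.1 hj).1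
    _ ≤ ∑ j ∈ S₀, 4 * (8 * ε * X) * walks N k (S₀.erase j) j :=
        Finset.sum_le_sum_of_subset_of_nonneg
          ((Finset.filter_subset _ _).trans Finset.sdiff_subset) fun j _ _ =>
            mul_nonneg (mul_nonneg (by norm_num) h.step_nonneg) (walks_nonneg _ _ _ _)

theorem PeelState.Sound.drift_le_one (h : Regime ar n k B ε X η) (hp : Peels N k x X η S₀)
    (hs : st.Sound N x S₀ (8 * ε * X)) (i : Fin M) :
    8 * ε * X + drift N x st.xhat (S₀ \ st.rest) (8 * ε * X) i ≤ 1 := by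
  linarith [hs.drift_le_errBound h hp i, h.errBound_le_one]

theorem PeelState.Sound.abs_xhat_sub_le (h : Regime ar n k B ε X η) (hp : Peels N k x X η S₀)
    (hs : st.Sound N x S₀ (8 * ε * X)) (hrest : st.rest = ∅) (j : Fin n) :
    |st.xhat j - x j| ≤ errBound k ε X ∧ (x j = 0 → st.xhat j = 0) := by
  by_cases hj : j ∈ S₀
  · refine ⟨?_, fun hxj => absurd hxj ((hp.mem_iff j).1 hj)⟩
    have hsingle := Finset.single_le_sum (f := fun j => 4 * (8 * ε * X) * walks N k (S₀.erase j) j)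
      (fun j _ => mul_nonneg (mul_nonneg (by norm_num) h.step_nonneg) (walks_nonneg _ _ _ _)) hj
    linarith [hs.err_le_walks h.step_nonneg hp.card_le (j := j) (by simp [hrest, hj]),
      h.step_add_sum_walks_le hp.not_manyWalks, h.step_nonneg]
  · have hxj : x j = 0 := by simpa using mt (hp.mem_iff j).2 hj
    rw [hs.xhat_eq_zero j (by simp [hj]), hxj, sub_zero, abs_zero]
    exact ⟨h.errBound_nonneg, fun _ => rfl⟩

theorem PeelState.Sound.exists_parent (h : Regime ar n k B ε X η) (hp : Peels N k x X η S₀)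
    (hs : st.Sound N x S₀ (8 * ε * X)) {i : Fin M} (hi : i ∈ leaves N st.rest) :
    ∃ j ∈ st.rest, i ∈ N j ∧ st.rest.filter (i ∈ N ·) = {j} ∧
      candidate ar N (st.resI i) i = some j ∧ |entry ar (st.resI i) j - x j| ≤
        2 * (8 * ε * X + drift N x st.xhat (S₀ \ st.rest) (8 * ε * X) i) + 8 * ε * X := by
  obtain ⟨j, hj⟩ := Finset.card_eq_one.1 (mem_leaves.1 hi)
  obtain ⟨hjrest, hij⟩ := Finset.mem_filter.1 (hj.symm ▸ Finset.mem_singleton_self j)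
  have hres := hs.isResidual i
  rw [contrib_eq_of_filter_eq_singleton hj] at hres
  exact ⟨j, hjrest, hij, hj,
    h.candidate_eq_some hij (hres.trans (hs.drift_le_errBound h hp i))
      (hp.eta_le j (hs.rest_subset hjrest)) (hp.le_X j),
    h.abs_entry_sub_le j hres (hs.drift_le_one h hp i) (hp.le_X j)⟩

theorem PeelState.Sound.entry_bound_le (h : Regime ar n k B ε X η) (hp : Peels N k x X η S₀)
    (hs : st.Sound N x S₀ (8 * ε * X)) (i : Fin M) :
    2 * (8 * ε * X + drift N x st.xhat (S₀ \ st.rest) (8 * ε * X) i) + 8 * ε * X ≤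
      3 * errBound k ε X := by
  linarith [hs.drift_le_errBound h hp i, h.step_le_errBound]

theorem PeelState.Sound.decodeNode (h : Regime ar n k B ε X η) (hp : Peels N k x X η S₀)
    (hs : st.Sound N x S₀ (8 * ε * X)) {i : Fin M} {j : Fin n} (hj : j ∈ st.rest) (hij : i ∈ N j)
    {v : ℝ} (hv : |v - x j| ≤
      2 * (8 * ε * X + drift N x st.xhat (S₀ \ st.rest) (8 * ε * X) i) + 8 * ε * X) :
    (st.decodeNode ar N j v).Sound N x S₀ (8 * ε * X) := by
  have hD : S₀ \ (st.decodeNode ar N j v).rest = insert j (S₀ \ st.rest) :=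
    Finset.sdiff_erase (hs.rest_subset hj)
  have hjD : j ∉ S₀ \ st.rest := fun hjD => (Finset.mem_sdiff.1 hjD).2 hj
  refine ⟨(Finset.erase_subset _ _).trans hs.rest_subset, fun a ha => ?_, fun a ha => ?_,
    hs.isResidual.decodeNode h hp hs.rest_subset (hs.drift_le_one h hp) (fun _ => norm_coefI) hj
      (by linarith [hs.entry_bound_le h hp i, h.errBound_le_one])⟩
  · rw [hD, Finset.mem_insert, not_or] at ha
    exact (Function.update_of_ne ha.1 _ _).trans (hs.xhat_eq_zero a ha.2)
  · rw [hD] at ha ⊢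
    rw [Finset.card_insert_of_notMem hjD]
    rcases Finset.mem_insert.1 ha with rfl | haD
    · rw [Finset.erase_insert hjD]
      simp only [PeelState.decodeNode, Function.update_self]
      linarith [add_drift_le_walks h.step_nonneg hs.err_le hij]
    · simp only [PeelState.decodeNode, Function.update_of_ne (ne_of_mem_of_not_mem haD hjD)]
      exact (hs.err_le a haD).trans (mul_le_mul_of_nonneg_left
        (walks_mono N (Nat.le_succ _) (Finset.erase_subset_erase _ (Finset.subset_insert _ _)) a)
        (mul_nonneg (by norm_num) h.step_nonneg))

variable {pick : ℕ → Finset (Fin M) → Fin M} {t : ℕ}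

theorem PeelState.next_of_leaves_eq_empty (hl : leaves N st.rest = ∅) :
    st.next ar N pick t = st := if_pos hl

theorem PeelState.next_of_candidate_eq_some (hl : leaves N st.rest ≠ ∅) {i : Fin M}
    (hi : pick t (leaves N st.rest) = i) {j : Fin n} (hj : candidate ar N (st.resI i) i = some j) :
    st.next ar N pick t = st.decodeNode ar N j (entry ar (st.resI i) j) := by
  rw [PeelState.next, if_neg hl]
  simp only [hi, hj, Option.elim_some]

theorem PeelState.Sound.next (h : Regime ar n k B ε X η) (hp : Peels N k x X η S₀)
    (hs : st.Sound N x S₀ (8 * ε * X)) (hpick : ∀ t L, L.Nonempty → pick t L ∈ L) (t : ℕ) :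
    (st.next ar N pick t).Sound N x S₀ (8 * ε * X) ∧
      (st.next ar N pick t).rest.card ≤ st.rest.card - 1 := by
  by_cases hl : leaves N st.rest = ∅
  · have hrest : st.rest = ∅ := by
      by_contra hne
      exact hp.not_leafless ⟨st.rest, hs.rest_subset, Finset.nonempty_iff_ne_empty.2 hne, hl⟩
    rw [PeelState.next_of_leaves_eq_empty hl]
    exact ⟨hs, by simp [hrest]⟩
  · obtain ⟨j, hj, hij, -, hcand, hv⟩ :=
      hs.exists_parent h hp (hpick t _ (Finset.nonempty_iff_ne_empty.2 hl))
    rw [PeelState.next_of_candidate_eq_some hl rfl hcand]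
    exact ⟨hs.decodeNode h hp hj hij hv, (Finset.card_erase_of_mem hj).le⟩

theorem PeelState.Sound.run (h : Regime ar n k B ε X η) (hp : Peels N k x X η S₀)
    (hs : st.Sound N x S₀ (8 * ε * X)) (hpick : ∀ t L, L.Nonempty → pick t L ∈ L) (t : ℕ) :
    (st.run ar N pick t).Sound N x S₀ (8 * ε * X) ∧
      (st.run ar N pick t).rest.card ≤ st.rest.card - t := by
  induction t with
  | zero => exact ⟨hs, le_rfl⟩
  | succ t ih =>
    obtain ⟨hsound, hcard⟩ := ih.1.next h hp hpick t
    exact ⟨hsound, hcard.trans (by omega)⟩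

theorem PeelState.run_add_of_leaves_eq_empty (ht : leaves N (st.run ar N pick t).rest = ∅)
    (f : ℕ) : st.run ar N pick (t + f) = st.run ar N pick t := by
  induction f with
  | zero => rfl
  | succ f ih =>
    rw [← Nat.add_assoc, PeelState.run, ih, PeelState.next_of_leaves_eq_empty ht]

theorem PeelState.isResidual_init (h : Regime ar n k B ε X η) (hp : Peels N k x X η S₀)
    {a : Fin M → Fin n → ℂ} (ha : ∀ i j, ‖a i j‖ = 1) :
    (PeelState.init ar N x S₀).IsResidual N x S₀ (8 * ε * X) a
      fun i => ar.rndC (contrib N x S₀ (a i) i) := by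
  intro i
  have hrnd := h.norm_rndC_sub_le (z := contrib N x S₀ (a i) i)
    ((hp.norm_contrib_le h S₀ (ha i) i).trans (by linarith [h.n_le_n_mul, h.two_le_cast]))
  simp only [PeelState.init, drift, Finset.sdiff_self, Finset.filter_empty, Finset.sum_empty,
    add_zero]
  linarith [h.eps_le_step, h.eps_nonneg]

theorem PeelState.sound_init (h : Regime ar n k B ε X η) (hp : Peels N k x X η S₀) :
    (PeelState.init ar N x S₀).Sound N x S₀ (8 * ε * X) :=
  ⟨subset_rfl, fun _ _ => rfl, fun j hj => by simp [PeelState.init] at hj,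
    PeelState.isResidual_init h hp fun _ => norm_coefI⟩

end Runs

/-! ## The actual decoder -/

/-- At the right node `i` at least two entries of `x` are not yet decoded in the state `st`, but for
the phases `θ` their verification sum is, up to the tolerance, that of the candidate entry: the
failure event of the leaf test. -/
def Collision (ar : Arith) (N : Fin n → Finset (Fin M)) (x : Fin n → ℝ) (st : PeelState n M)
    (i : Fin M) (θ : Fin M → Fin n → Fin (2 ^ B)) : Prop :=
  2 ≤ (st.rest.filter (i ∈ N ·)).card ∧ ∃ j₀, candidate ar N (st.resI i) i = some j₀ ∧
    ‖phase B (θ i j₀) * entry ar (st.resI i) j₀ -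
      contrib N x st.rest (fun j => phase B (θ i j)) i‖ ≤ 2 * ar.tol

/-- Apart from the list of leaf nodes, the memory `μ` is that of a decoder in the state `st`, with
verification residuals of the accuracy `δ` plus drift. -/
structure Tracks (ω : Design n M d B) (x : Fin n → ℝ) (S₀ : Finset (Fin n)) (δ : ℝ)
    (st : PeelState n M) (μ : Memory n M) : Prop where
  resI_eq : μ.resI = st.resI
  xhat_eq : μ.xhat = st.xhat
  isResidual : st.IsResidual (nbrs ω) x S₀ δ (coefV ω) μ.resV

theorem leaves_erase_eq {N : Fin n → Finset (Fin M)} {R : Finset (Fin n)} {i : Fin M} {j : Fin n}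
    (hR : R.filter (i ∈ N ·) = {j}) {l : List (Fin M)} (hl : ∀ a, a ∈ l ↔ a ∈ N j ∧ a ≠ i) :
    {a ∈ (leaves N R).erase i | a ∉ l} ∪ {a ∈ leaves N (R.erase j) | a ∈ l} =
      leaves N (R.erase j) := by
  ext a
  simp only [Finset.mem_union, Finset.mem_filter, Finset.mem_erase, hl]
  rcases eq_or_ne a i with rfl | hai
  · have ha : a ∉ leaves N (R.erase j) := by simp [mem_leaves, Finset.filter_erase, hR]
    simp [ha]
  · by_cases haj : a ∈ N j
    · simp [hai, haj]
    · have ha : a ∈ leaves N R ↔ a ∈ leaves N (R.erase j) := by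
        rw [mem_leaves, mem_leaves, Finset.filter_erase, Finset.erase_eq_of_notMem (by simp [haj])]
      simp [hai, haj, ha]

section Coupling

variable {ar : Arith} {ε X η : ℝ} {x : Fin n → ℝ} {S₀ : Finset (Fin n)} {ω : Design n M d B}
  {st : PeelState n M} {μ : Memory n M}

namespace Tracks

theorem leafTest_eq_some (hμ : Tracks ω x S₀ (8 * ε * X) st μ) (h : Regime ar n k B ε X η)
    (hp : Peels (nbrs ω) k x X η S₀) (hs : st.Sound (nbrs ω) x S₀ (8 * ε * X)) {i : Fin M}
    (hi : i ∈ leaves (nbrs ω) st.rest) {j : Fin n}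
    (hj : candidate ar (nbrs ω) (st.resI i) i = some j) :
    (leafTest ar ω μ i).val = some (j, entry ar (st.resI i) j) := by
  obtain ⟨j', -, -, hfilter, hcand, hentry⟩ := hs.exists_parent h hp hi
  obtain rfl : j' = j := Option.some_injective _ (hcand.symm.trans hj)
  have hres := (hμ.isResidual i).trans (hs.drift_le_errBound h hp i)
  rw [contrib_eq_of_filter_eq_singleton hfilter] at hres
  rw [val_leafTest, hμ.resI_eq, hcand, Option.bind_some, if_pos (h.discrepancy_le
    (norm_coefV ω i j') (hp.le_X j') hres (hentry.trans (hs.entry_bound_le h hp i)))]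

theorem leafTest_eq_none (hμ : Tracks ω x S₀ (8 * ε * X) st μ) (h : Regime ar n k B ε X η)
    (hp : Peels (nbrs ω) k x X η S₀) (hs : st.Sound (nbrs ω) x S₀ (8 * ε * X)) {i : Fin M}
    (hi : i ∉ leaves (nbrs ω) st.rest) (hcol : ¬ Collision ar (nbrs ω) x st i ω.2) :
    (leafTest ar ω μ i).val = none := by
  have hres := (hs.isResidual i).trans (hs.drift_le_errBound h hp i)
  rw [val_leafTest, hμ.resI_eq]
  rcases Nat.lt_or_ge (st.rest.filter (i ∈ nbrs ω ·)).card 2 with hlt | hge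
  · have hempty : st.rest.filter (i ∈ nbrs ω ·) = ∅ := by
      rw [mem_leaves] at hi
      exact Finset.card_eq_zero.1 (by omega)
    rw [contrib, hempty, Finset.sum_empty, sub_zero] at hres
    rw [h.candidate_eq_none i hres, Option.bind_none]
  · rcases hcand : candidate ar (nbrs ω) (st.resI i) i with _ | j
    · rfl
    · have hsum := hp.norm_contrib_le h st.rest norm_coefI i
      have hnorm : ‖st.resI i‖ ≤ 2 * n * X := by
        linarith [norm_le_norm_add_norm_sub' (st.resI i) (contrib (nbrs ω) x st.rest coefI i),
          h.errBound_le_one, h.two_mul_le_n_mul, h.one_le_X]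
      exact if_neg fun hle => hcol ⟨hge, j, hcand, h.norm_le_of_discrepancy_le (norm_coefV ω i j)
        (h.abs_entry_le j hnorm) ((hμ.isResidual i).trans (hs.drift_le_errBound h hp i))
        (hp.norm_contrib_le h st.rest (norm_coefV ω i) i) hle⟩

theorem passing_eq_leaves (hμ : Tracks ω x S₀ (8 * ε * X) st μ) (h : Regime ar n k B ε X η)
    (hp : Peels (nbrs ω) k x X η S₀) (hs : st.Sound (nbrs ω) x S₀ (8 * ε * X))
    (hcol : ∀ i, ¬ Collision ar (nbrs ω) x st i ω.2) :
    passing ar ω μ = leaves (nbrs ω) st.rest := by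
  ext i
  by_cases hi : i ∈ leaves (nbrs ω) st.rest
  · obtain ⟨j, -, -, -, hcand, -⟩ := hs.exists_parent h hp hi
    simp [passing, hμ.leafTest_eq_some h hp hs hi hcand, hi]
  · simp [passing, hμ.leafTest_eq_none h hp hs hi (hcol i), hi]

theorem decodeNode (hμ : Tracks ω x S₀ (8 * ε * X) st μ) (h : Regime ar n k B ε X η)
    (hp : Peels (nbrs ω) k x X η S₀) (hs : st.Sound (nbrs ω) x S₀ (8 * ε * X)) {j : Fin n}
    (hj : j ∈ st.rest) {v : ℝ} (hv : |v - x j| ≤ 1) :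
    Tracks ω x S₀ (8 * ε * X) (st.decodeNode ar (nbrs ω) j v) (μ.decodeNode ar ω j v) :=
  ⟨by simp only [Memory.decodeNode, PeelState.decodeNode, hμ.resI_eq],
    by simp only [Memory.decodeNode, PeelState.decodeNode, hμ.xhat_eq],
    hμ.isResidual.decodeNode h hp hs.rest_subset (hs.drift_le_one h hp) (norm_coefV ω) hj hv⟩

end Tracks

variable {pick : ℕ → Finset (Fin M) → Fin M}

theorem xhat_peel_eq (h : Regime ar n k B ε X η) (hp : Peels (nbrs ω) k x X η S₀)
    (hpick : ∀ t L, L.Nonempty → pick t L ∈ L) (hs : st.Sound (nbrs ω) x S₀ (8 * ε * X)) {T : ℕ}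
    (hcol : ∀ t ≤ T, ∀ i, ¬ Collision ar (nbrs ω) x (st.run ar (nbrs ω) pick t) i ω.2)
    (f t : ℕ) (hT : t + f ≤ T) {μ : Memory n M}
    (hμ : Tracks ω x S₀ (8 * ε * X) (st.run ar (nbrs ω) pick t) μ)
    (hleaf : μ.leaf = leaves (nbrs ω) (st.run ar (nbrs ω) pick t).rest) :
    (peel ar ω pick f t μ).val.xhat = (st.run ar (nbrs ω) pick (t + f)).xhat := by
  induction f generalizing t μ with
  | zero => exact hμ.xhat_eq
  | succ f ih =>
    have hst := (hs.run h hp hpick t).1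
    have hst' := (hs.run h hp hpick (t + 1)).1
    by_cases hempty : leaves (nbrs ω) (st.run ar (nbrs ω) pick t).rest = ∅
    · rw [val_peel_of_leaf_eq_empty _ (hleaf.trans hempty), hμ.xhat_eq,
        PeelState.run_add_of_leaves_eq_empty hempty]
    · have hi := hpick t _ (Finset.nonempty_iff_ne_empty.2 hempty)
      obtain ⟨j, hj, -, hfilter, hcand, hentry⟩ := hst.exists_parent h hp hi
      have hnext : st.run ar (nbrs ω) pick (t + 1) = _ :=
        PeelState.next_of_candidate_eq_some hempty rfl hcand
      have hμ' := hμ.decodeNode h hp hst hj (hentry.trans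
        ((hst.entry_bound_le h hp _).trans (by linarith [h.errBound_le_one])))
      rw [← hnext] at hμ'
      rw [val_peel_succ f (hleaf.trans_ne hempty) (congrArg _ hleaf)
        (hμ.leafTest_eq_some h hp hst hi hcand),
        hμ'.passing_eq_leaves h hp hst' (hcol (t + 1) (by omega)), ← Nat.add_assoc,
        Nat.add_right_comm]
      refine ih (t + 1) (by omega) ⟨hμ'.resI_eq, hμ'.xhat_eq, hμ'.isResidual⟩ ?_
      rw [hleaf, hnext]
      exact leaves_erase_eq hfilter fun a => by
        rw [(nodup_nbrList ω j).mem_erase_iff, mem_nbrList, and_comm]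

theorem abs_decode_sub_le (h : Regime ar n k B ε X η) (hp : Peels (nbrs ω) k x X η S₀)
    (hpick : ∀ t L, L.Nonempty → pick t L ∈ L)
    (hcol : ∀ t ≤ k, ∀ i, ¬ Collision ar (nbrs ω) x
      ((PeelState.init ar (nbrs ω) x S₀).run ar (nbrs ω) pick t) i ω.2)
    {y : Fin M × Fin 2 → ℂ} (hyI : ∀ i, y (i, 0) = contrib (nbrs ω) x S₀ coefI i)
    (hyV : ∀ i, y (i, 1) = contrib (nbrs ω) x S₀ (coefV ω i) i) (j : Fin n) :
    |(decode ar ω pick k y).val j - x j| ≤ errBound k ε X ∧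
      (x j = 0 → (decode ar ω pick k y).val j = 0) := by
  have hs := PeelState.sound_init h hp
  have hμ : Tracks ω x S₀ (8 * ε * X) (PeelState.init ar (nbrs ω) x S₀)
      (Memory.ofMeasurement ar y) :=
    ⟨by simp only [Memory.ofMeasurement, PeelState.init, hyI], rfl,
      by simpa only [Memory.ofMeasurement, hyV] using PeelState.isResidual_init h hp (norm_coefV ω)⟩
  obtain ⟨hrun, hcard⟩ := hs.run h hp hpick k
  have hrest : ((PeelState.init ar (nbrs ω) x S₀).run ar (nbrs ω) pick k).rest = ∅ :=
    Finset.card_eq_zero.1 (Nat.le_zero.1 (hcard.trans (Nat.sub_eq_zero_of_le hp.card_le).le))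
  have hdecode : (decode ar ω pick k y).val =
      ((PeelState.init ar (nbrs ω) x S₀).run ar (nbrs ω) pick k).xhat := by
    rw [val_decode, hμ.passing_eq_leaves h hp hs (hcol 0 k.zero_le)]
    have hpeel := xhat_peel_eq h hp hpick hs hcol k 0 (Nat.zero_add k).le
      (μ := { Memory.ofMeasurement ar y with
        leaf := leaves (nbrs ω) (PeelState.init ar (nbrs ω) x S₀).rest })
      ⟨hμ.resI_eq, hμ.xhat_eq, hμ.isResidual⟩ rfl
    rwa [Nat.zero_add] at hpeel
  rw [hdecode]
  exact hrun.abs_xhat_sub_le h hp hrest j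

end Coupling

section Collisions

variable {ar : Arith} {ε X η : ℝ} {x : Fin n → ℝ}

theorem prob_collision_le (h : Regime ar n k B ε X η) {st : PeelState n M}
    (hη : ∀ j ∈ st.rest, η ≤ |x j|) (N : Fin n → Finset (Fin M)) (i : Fin M) :
    prob {θ : Fin M → Fin n → Fin (2 ^ B) | Collision ar N x st i θ} ≤ 1 / 2 ^ B := by
  have hr : 2 * (2 * ar.tol) * 2 ^ B < η := by linarith [h.tol_le, h.eta_pos]
  by_cases hcard : 2 ≤ (st.rest.filter (i ∈ N ·)).card ∧ candidate ar N (st.resI i) i ≠ none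
  · obtain ⟨j₀, hj₀⟩ := Option.ne_none_iff_exists'.1 hcard.2
    refine prob_le_of_forall_update i (by positivity) fun θ => le_trans (prob_mono ?_)
      (prob_norm_sub_sum_phase_le hr hcard.1 (fun j hj => hη j (Finset.mem_filter.1 hj).1) j₀
        (entry ar (st.resI i) j₀))
    rintro s ⟨-, j, hj, hle⟩
    obtain rfl : j₀ = j := Option.some_injective _ (hj₀.symm.trans hj)
    simpa only [Set.mem_ofPred_eq, contrib, Function.update_self] using hle
  · refine (prob_mono (F := ∅) ?_).trans (prob_empty.trans_le (by positivity))
    rintro θ ⟨htwo, j, hj, -⟩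
    exact hcard ⟨htwo, by simp [hj]⟩

theorem prob_exists_collision_le (h : Regime ar n k B ε X η) {st : ℕ → PeelState n M}
    (hη : ∀ t, ∀ j ∈ (st t).rest, η ≤ |x j|) (N : Fin n → Finset (Fin M)) (T : ℕ) :
    prob {θ : Fin M → Fin n → Fin (2 ^ B) | ∃ t ≤ T, ∃ i, Collision ar N x (st t) i θ} ≤
      (T + 1) * M / 2 ^ B := by
  calc prob {θ : Fin M → Fin n → Fin (2 ^ B) | ∃ t ≤ T, ∃ i, Collision ar N x (st t) i θ}
    _ ≤ prob (⋃ p ∈ Finset.range (T + 1) ×ˢ Finset.univ,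
          {θ : Fin M → Fin n → Fin (2 ^ B) | Collision ar N x (st p.1) p.2 θ}) := by
        refine prob_mono ?_
        rintro θ ⟨t, ht, i, hcol⟩
        exact Set.mem_biUnion (x := (t, i)) (by simpa using Nat.lt_succ_of_le ht) hcol
    _ ≤ ∑ p ∈ Finset.range (T + 1) ×ˢ Finset.univ,
          prob {θ : Fin M → Fin n → Fin (2 ^ B) | Collision ar N x (st p.1) p.2 θ} :=
        prob_biUnion_le _ _
    _ ≤ ∑ _ ∈ Finset.range (T + 1) ×ˢ (Finset.univ : Finset (Fin M)), 1 / 2 ^ B :=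
        Finset.sum_le_sum fun p _ => prob_collision_le h (hη p.1) N p.2
    _ = (T + 1) * M / 2 ^ B := by simp [div_eq_mul_inv]

end Collisions

theorem sum_ite_mul_eq_contrib (N : Fin n → Finset (Fin M)) {x : Fin n → ℝ} {S₀ : Finset (Fin n)}
    (hS₀ : ∀ j, j ∈ S₀ ↔ x j ≠ 0) (a : Fin n → ℂ) (i : Fin M) :
    ∑ j, (if i ∈ N j then a j else 0) * (x j : ℂ) = contrib N x S₀ a i := by
  rw [contrib, Finset.sum_filter, ← Finset.sum_subset S₀.subset_univ fun j _ hj => by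
    rw [not_not.1 (mt (hS₀ j).2 hj), Complex.ofReal_zero, mul_zero]]
  exact Finset.sum_congr rfl fun j _ => by rw [ite_mul, zero_mul, mul_comm]

theorem exists_support_card_le {x : Fin n → ℝ} (hx : Sparse k x) :
    ∃ S₀ : Finset (Fin n), (∀ j, j ∈ S₀ ↔ x j ≠ 0) ∧ S₀.card ≤ k := by
  classical
  refine ⟨Finset.univ.filter (x · ≠ 0), by simp, ?_⟩
  rw [← Set.ncard_coe_finset]
  simpa [Sparse] using hx

theorem add_one_mul_div_two_pow_clog_le (c : ℕ) (hk : 1 ≤ k) :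
    ((k : ℝ) + 1) * (c * k : ℕ) / 2 ^ (3 * Nat.clog 2 k) ≤ 2 * c / k := by
  have hk' : (1 : ℝ) ≤ k := by exact_mod_cast hk
  have hpow : (k : ℝ) ^ 3 ≤ 2 ^ (3 * Nat.clog 2 k) := by
    rw [Nat.mul_comm, pow_mul]
    exact pow_le_pow_left₀ (by positivity) (by exact_mod_cast Nat.le_pow_clog one_lt_two k) 3
  calc ((k : ℝ) + 1) * (c * k : ℕ) / 2 ^ (3 * Nat.clog 2 k)
    _ ≤ (k + k) * (c * k : ℕ) / k ^ 3 := by gcongr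
    _ = 2 * c / k := by
        push_cast
        field_simp
        ring

theorem prob_not_peels_le {c : ℕ} (hd : 3 ≤ d) (hc : 6 * d ^ 2 ≤ c) (hk : 1 ≤ k)
    {x : Fin n → ℝ} {X η : ℝ} {S₀ : Finset (Fin n)} (hS₀ : ∀ j, j ∈ S₀ ↔ x j ≠ 0)
    (hcard : S₀.card ≤ k) (hη : ∀ j, x j ≠ 0 → η ≤ |x j|) (hX : ∀ j, |x j| ≤ X) :
    prob {g : Fin n → SubsetsOfCard (Fin (c * k)) d | ¬ Peels (fun j => (g j).1) k x X η S₀} ≤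
      2 / k := by
  have hleafless := prob_leafless_le (V := Fin n) (W := Fin (c * k)) hd
    (by rw [Fintype.card_fin]; gcongr; nlinarith) hcard
  have hwalks := prob_manyWalks_le (V := Fin n) (W := Fin (c * k)) (d := d) hk
    (by rw [Fintype.card_fin]; gcongr; omega) hcard
  refine (prob_mono fun g hg => ?_).trans ((prob_union_le _ _).trans
    ((add_le_add hleafless hwalks).trans_eq (by ring)))
  by_contra hgood
  rw [Set.mem_union, not_or] at hgood
  exact hg ⟨hS₀, hcard, fun j hj => hη j ((hS₀ j).1 hj), hX, hgood.2, hgood.1⟩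

/-- Decoding the measurements of `x` taken with the design `ω` recovers every entry up to an error
`δ`, and the zero entries exactly. -/
def Recovers (ar : Arith) (pick : ℕ → Finset (Fin M) → Fin M) (k : ℕ) (x : Fin n → ℝ) (δ : ℝ)
    (ω : Design n M d B) : Prop :=
  ∀ j, |(decode ar ω pick k (measure ω x)).val j - x j| ≤ δ ∧
    (x j = 0 → (decode ar ω pick k (measure ω x)).val j = 0)

theorem prob_not_recovers_le {ar : Arith} {ε X η : ℝ} (h : Regime ar n k B ε X η)
    {x : Fin n → ℝ} {S₀ : Finset (Fin n)} {g : Fin n → SubsetsOfCard (Fin M) d}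
    (hp : Peels (fun j => (g j).1) k x X η S₀) {pick : ℕ → Finset (Fin M) → Fin M}
    (hpick : ∀ t L, L.Nonempty → pick t L ∈ L) :
    prob {θ : Fin M → Fin n → Fin (2 ^ B) | ¬ Recovers ar pick k x (errBound k ε X) (g, θ)} ≤
      (k + 1) * M / 2 ^ B := by
  refine (prob_mono fun θ hθ => ?_).trans (prob_exists_collision_le (T := k) h
    (fun t j hj => hp.eta_le j (((PeelState.sound_init h hp).run h hp hpick t).1.rest_subset hj))
    (fun j => (g j).1))
  by_contra hcol
  simp only [Set.mem_ofPred_eq, not_exists, not_and] at hcol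
  refine hθ fun j => abs_decode_sub_le (ω := (g, θ)) h hp hpick hcol (fun i => ?_) (fun i => ?_) j
  all_goals
    rw [← sum_ite_mul_eq_contrib _ hp.mem_iff]
    simp [measure, Matrix.mulVec, dotProduct, sensing]

theorem le_prob_recovers_of_prob_not_peels_le {ar : Arith} {ε X η p : ℝ}
    (h : Regime ar n k B ε X η) {x : Fin n → ℝ} {S₀ : Finset (Fin n)}
    [Nonempty (Design n M d B)]
    (hp : prob {g : Fin n → SubsetsOfCard (Fin M) d | ¬ Peels (fun j => (g j).1) k x X η S₀} ≤ p)
    {pick : ℕ → Finset (Fin M) → Fin M} (hpick : ∀ t L, L.Nonempty → pick t L ∈ L) :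
    1 - (p + (k + 1) * M / 2 ^ B) ≤
      prob {ω : Design n M d B | Recovers ar pick k x (errBound k ε X) ω} := by
  set E := {ω : Design n M d B | Recovers ar pick k x (errBound k ε X) ω}
  have hcollision : ∀ g ∈ {g : Fin n → SubsetsOfCard (Fin M) d |
      Peels (fun j => (g j).1) k x X η S₀}, prob {θ | (g, θ) ∉ E} ≤ (k + 1) * M / 2 ^ B :=
    fun g hg => prob_not_recovers_le h hg hpick
  exact le_prob_prod hp (by positivity) hcollision

theorem le_prob_recovers {c : ℕ} (hd : 3 ≤ d) (hc : 6 * d ^ 2 ≤ c) (hk : 1 ≤ k) {ar : Arith}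
    {ε X η : ℝ} (h : Regime ar n k (3 * Nat.clog 2 k) ε X η) {x : Fin n → ℝ} (hx : Sparse k x)
    (hη : ∀ j, x j ≠ 0 → η ≤ |x j|) (hX : ∀ j, |x j| ≤ X)
    {pick : ℕ → Finset (Fin (c * k)) → Fin (c * k)} (hpick : ∀ t L, L.Nonempty → pick t L ∈ L) :
    1 - (2 + 2 * c : ℝ) / k ≤ prob {ω : Design n (c * k) d (3 * Nat.clog 2 k) |
      Recovers ar pick k x (errBound k ε X) ω} := by
  obtain ⟨S₀, hS₀, hcard⟩ := exists_support_card_le hx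
  have hd_le : d ≤ c * k := by nlinarith
  have : Nonempty (SubsetsOfCard (Fin (c * k)) d) :=
    nonempty_subsetsOfCard (hd_le.trans_eq (Fintype.card_fin _).symm)
  have : Nonempty (Design n (c * k) d (3 * Nat.clog 2 k)) :=
    inferInstanceAs (Nonempty ((_ → SubsetsOfCard _ _) × (_ → _ → Fin (2 ^ _))))
  have hrec := le_prob_recovers_of_prob_not_peels_le h
    (prob_not_peels_le hd hc hk hS₀ hcard hη hX) hpick
  refine le_trans ?_ hrec
  rw [add_div]
  linarith [add_one_mul_div_two_pow_clog_le c hk]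

/-! ## Exact and fixed-point arithmetic -/

section Exact

open Filter Topology

theorem exists_forall_le_abs (x : Fin n → ℝ) :
    ∃ η : ℝ, 0 < η ∧ η ≤ 1 ∧ ∀ j, x j ≠ 0 → η ≤ |x j| := by
  have hle {a : ℝ} (ha : 0 < a) : ∀ᶠ η in 𝓝[>] (0 : ℝ), η ≤ a :=
    nhdsWithin_le_nhds (eventually_le_nhds ha)
  have hall : ∀ᶠ η in 𝓝[>] (0 : ℝ), ∀ j, x j ≠ 0 → η ≤ |x j| := eventually_all.2 fun j =>
    eventually_imp_distrib_left.2 fun hj => hle (abs_pos.2 hj)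
  exact (eventually_mem_nhdsWithin.and ((hle one_pos).and hall)).exists

theorem regime_exact (hn : 2 ≤ n) {X η : ℝ} (hX : 1 ≤ X) (hη : 0 < η) (hη1 : η ≤ 1) :
    Regime exact n k B 0 X η where
  two_le := hn
  eps_nonneg := le_rfl
  acc r _ := by simp [exact]
  one_le_X := hX
  eta_pos := hη
  eta_le := hη1
  err_le := by simp [errBound, exact]
  tol_le := by simp [exact, hη.le]

theorem le_prob_decode_exact {c : ℕ} (hd : 3 ≤ d) (hc : 6 * d ^ 2 ≤ c) (hn : 2 ≤ n) (hk : 1 ≤ k)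
    {pick : ℕ → Finset (Fin (c * k)) → Fin (c * k)} (hpick : ∀ t L, L.Nonempty → pick t L ∈ L)
    {x : Fin n → ℝ} (hx : Sparse k x) :
    1 - (2 + 2 * c : ℝ) / k ≤ prob {ω : Design n (c * k) d (3 * Nat.clog 2 k) |
      (decode exact ω pick k (measure ω x)).val = x} := by
  obtain ⟨η, hη, hη1, hηx⟩ := exists_forall_le_abs x
  have hregime := regime_exact (k := k) (B := 3 * Nat.clog 2 k) hn (X := 1 + ‖x‖) (by simp) hη hη1
  refine (le_prob_recovers hd hc hk hregime hx hηx
    (fun j => (norm_le_pi_norm x j).trans (by linarith)) hpick).trans (prob_mono fun ω hω => ?_)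
  funext j
  have hj := (hω j).1
  rw [errBound, mul_zero, zero_mul, zero_mul] at hj
  exact sub_eq_zero.1 (abs_nonpos_iff.1 hj)

end Exact

section FixedPoint

theorem abs_fix_sub_le (s : ℕ) {r : ℝ} (hr : |r| ≤ 2 ^ s) : |fix s r - r| ≤ (2 ^ s)⁻¹ := by
  have hs : (0 : ℝ) < 2 ^ s := by positivity
  have hclamp : max (-(2 ^ s)) (min (2 ^ s) r) = r := by
    rw [min_eq_right (abs_le.1 hr).2, max_eq_right (abs_le.1 hr).1]
  calc |fix s r - r|
    _ = |max (-(2 ^ s)) (min (2 ^ s) ((round (r * 2 ^ s) : ℝ) / 2 ^ s)) -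
          max (-(2 ^ s)) (min (2 ^ s) r)| := by rw [hclamp, fix]
    _ ≤ |(round (r * 2 ^ s) : ℝ) / 2 ^ s - r| := by
        rw [max_comm, max_comm (-(2 ^ s))]
        refine (abs_max_sub_max_le_abs _ _ _).trans ?_
        rw [min_comm, min_comm (2 ^ s)]
        simpa using abs_min_sub_min_le_max ((round (r * 2 ^ s) : ℝ) / 2 ^ s) (2 ^ s) r (2 ^ s)
    _ = |r * 2 ^ s - round (r * 2 ^ s)| * (2 ^ s)⁻¹ := by
        rw [abs_sub_comm, ← abs_of_pos hs, ← abs_inv, ← abs_mul, abs_of_pos hs, sub_mul,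
          mul_inv_cancel_right₀ hs.ne', div_eq_mul_inv]
    _ ≤ 1 * (2 ^ s)⁻¹ := by
        gcongr
        linarith [abs_sub_round (r * 2 ^ s)]
    _ = (2 ^ s)⁻¹ := one_mul _

theorem mul_errBound_inv_pow_le {z : ℝ} (hz : 2 ≤ z) (hn : n ≤ z) (hk : k ≤ z) (κ : ℕ) :
    1000 * n * errBound k (z ^ (2 * κ + 27))⁻¹ 1 ≤ (z ^ (κ + 7))⁻¹ * (z ^ κ)⁻¹ := by
  have : 0 < z := two_pos.trans_le hz
  have hpow : (2 : ℝ) ^ 17 ≤ z ^ 17 := pow_le_pow_left₀ two_pos.le hz 17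
  have hone : 1 ≤ z ^ 2 := one_le_pow₀ (one_le_two.trans hz)
  calc 1000 * n * errBound k (z ^ (2 * κ + 27))⁻¹ 1
    _ = 8000 * n * (1 + 8 * (k : ℝ) ^ 2) * (z ^ (2 * κ + 27))⁻¹ := by
        rw [errBound]
        ring
    _ ≤ 8000 * z * (z ^ 2 + 8 * z ^ 2) * (z ^ (2 * κ + 27))⁻¹ := by gcongr
    _ = 72000 * (z ^ 3 * (z ^ (2 * κ + 27))⁻¹) := by ring
    _ ≤ z ^ 17 * (z ^ 3 * (z ^ (2 * κ + 27))⁻¹) := by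
        gcongr
        linarith
    _ = (z ^ (κ + 7))⁻¹ * (z ^ κ)⁻¹ := by
        field_simp
        ring

theorem regime_fixedPoint {p : ℕ} (hn : 2 ≤ n) (hkn : k ≤ n) (hp : n ≤ 2 ^ p) (κ : ℕ) :
    Regime (fixedPoint ((2 * κ + 27) * p) ((κ + 7) * p)) n k (3 * Nat.clog 2 k)
      (2 ^ ((2 * κ + 27) * p))⁻¹ 1 (2 ^ (κ * p))⁻¹ := by
  set z : ℝ := 2 ^ p with hz
  have hnz : (n : ℝ) ≤ z := by simpa [hz] using (Nat.cast_le (α := ℝ)).2 hp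
  have hz2 : 2 ≤ z := le_trans (by exact_mod_cast hn) hnz
  have hpow (a : ℕ) : (2 : ℝ) ^ (a * p) = z ^ a := by rw [hz, ← pow_mul, mul_comm]
  have htol : (fixedPoint ((2 * κ + 27) * p) ((κ + 7) * p)).tol = (z ^ (κ + 7))⁻¹ := by
    rw [fixedPoint, zpow_neg, zpow_natCast, hpow]
  refine ⟨hn, by positivity, fun r hr => abs_fix_sub_le _ (hr.trans ?range), le_rfl, by positivity,
    inv_le_one_of_one_le₀ (one_le_pow₀ one_le_two), ?err, ?resolution⟩
  case range =>
    calc 100 * (n : ℝ) * 1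
      _ ≤ z ^ 7 * z := by
          rw [mul_one]
          gcongr
          linarith [pow_le_pow_left₀ two_pos.le hz2 7]
      _ = z ^ 8 := by ring
      _ ≤ z ^ (2 * κ + 27) := pow_le_pow_right₀ (by linarith) (by omega)
      _ = 2 ^ ((2 * κ + 27) * p) := (hpow _).symm
  case err =>
    rw [htol, hpow, hpow]
    exact mul_errBound_inv_pow_le hz2 hnz (le_trans (by exact_mod_cast hkn) hnz) κ
  case resolution =>
    have hB : (2 : ℝ) ^ (3 * Nat.clog 2 k) ≤ z ^ 3 := by
      rw [← hpow]
      have hclog : Nat.clog 2 k ≤ p := Nat.clog_le_of_le_pow (hkn.trans hp)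
      gcongr
      exact one_le_two
    calc 16 * (fixedPoint _ ((κ + 7) * p)).tol * 2 ^ (3 * Nat.clog 2 k)
      _ ≤ z ^ 4 * (z ^ (κ + 7))⁻¹ * z ^ 3 := by
          rw [htol]
          gcongr
          linarith [pow_le_pow_left₀ two_pos.le hz2 4]
      _ = (2 ^ (κ * p))⁻¹ := by
          rw [hpow]
          field_simp
          ring

end FixedPoint

section L1

variable {x y : Fin n → ℝ}

theorem l1_eq_norm (x : Fin n → ℝ) : l1 x = ‖WithLp.toLp 1 x‖ := by
  simp [l1, PiLp.norm_eq_of_L1]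

theorem l1_nonneg (x : Fin n → ℝ) : 0 ≤ l1 x := (norm_nonneg _).trans_eq (l1_eq_norm x).symm

theorem l1_eq_zero_iff : l1 x = 0 ↔ x = 0 := by
  rw [l1_eq_norm, norm_eq_zero, WithLp.toLp_eq_zero]

theorem l1_smul (a : ℝ) (x : Fin n → ℝ) : l1 (a • x) = |a| * l1 x := by
  simp only [l1_eq_norm, WithLp.toLp_smul, norm_smul, Real.norm_eq_abs]

theorem l1_sub_comm (x y : Fin n → ℝ) : l1 (x - y) = l1 (y - x) := by
  simp only [l1_eq_norm, WithLp.toLp_sub, norm_sub_rev]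

theorem l1_sub_le (x y z : Fin n → ℝ) : l1 (x - z) ≤ l1 (x - y) + l1 (y - z) := by
  simp only [l1_eq_norm, WithLp.toLp_sub]
  exact norm_sub_le_norm_sub_add_norm_sub _ _ _

theorem abs_le_l1 (x : Fin n → ℝ) (j : Fin n) : |x j| ≤ l1 x :=
  (PiLp.norm_apply_le (WithLp.toLp 1 x) j).trans_eq (l1_eq_norm x).symm

theorem l1_le_mul {δ : ℝ} (hx : ∀ j, |x j| ≤ δ) : l1 x ≤ n * δ :=
  (Finset.sum_le_card_nsmul _ _ _ fun j _ => hx j).trans_eq (by simp)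

theorem Sparse.mono (hx : Sparse k x) (hy : ∀ j, y j ≠ 0 → x j ≠ 0) : Sparse k y :=
  (Set.ncard_le_ncard hy (Set.toFinite _)).trans hx

end L1

theorem two_zpow_neg_succ (P : ℕ) : (2 : ℝ) ^ (-((P : ℤ) + 1)) = 2 ^ (-(P : ℤ)) / 2 := by
  rw [neg_add', zpow_sub_one₀ two_ne_zero, div_eq_mul_inv]

theorem two_zpow_neg_le_one (P : ℕ) : (2 : ℝ) ^ (-(P : ℤ)) ≤ 1 :=
  zpow_le_one_of_nonpos₀ one_le_two (by omega)

namespace Represents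

variable {P R : ℕ} {e : ℤ} {x x' : Fin n → ℝ}

theorem smul_zpow_neg (h : Represents k P R e x x') :
    Represents k P R 0 ((2 : ℝ) ^ (-e) • x) ((2 : ℝ) ^ (-e) • x') := by
  have he : (0 : ℝ) < 2 ^ (-e) := by positivity
  refine ⟨h.1.mono fun j hj => right_ne_zero_of_mul hj, ?_, fun j hj => ?_⟩
  · rw [← smul_sub, l1_smul, l1_smul, mul_left_comm]
    exact mul_le_mul_of_nonneg_left h.2.1 (abs_nonneg _)
  · obtain ⟨hlow, hhigh⟩ := h.2.2 j (right_ne_zero_of_mul hj)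
    rw [Pi.smul_apply, smul_eq_mul, abs_mul, abs_of_pos he]
    have hscale (m : ℤ) : (2 : ℝ) ^ (0 + m) = 2 ^ (-e) * 2 ^ (e + m) := by
      rw [← zpow_add₀ two_ne_zero]
      congr 1
      ring
    rw [sub_eq_add_neg, hscale, ← add_zero (0 : ℤ), hscale, add_zero]
    exact ⟨mul_le_mul_of_nonneg_left hlow he.le, mul_le_mul_of_nonneg_left hhigh he.le⟩

theorem abs_apply_le (h : Represents k P R e x x') (j : Fin n) : |x' j| ≤ 2 ^ e := by
  rcases eq_or_ne (x' j) 0 with hj | hj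
  · rw [hj, abs_zero]
    positivity
  · exact (h.2.2 j hj).2

theorem inv_two_pow_le_abs_apply (h : Represents k P R 0 x x') {j : Fin n} (hj : x' j ≠ 0) :
    (2 ^ R)⁻¹ ≤ |x' j| := by
  simpa only [zero_sub, zpow_neg, zpow_natCast] using (h.2.2 j hj).1

theorem l1_sub_le_half (h : Represents k P R e x x') : l1 (x - x') ≤ l1 x / 2 := by
  have hacc := h.2.1
  rw [two_zpow_neg_succ] at hacc
  linarith [mul_le_mul_of_nonneg_right (two_zpow_neg_le_one P) (l1_nonneg x)]

theorem l1_le_two_mul (h : Represents k P R e x x') : l1 x' ≤ 2 * l1 x := by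
  have htri := l1_sub_le x' x 0
  rw [sub_zero, sub_zero, l1_sub_comm] at htri
  linarith [h.l1_sub_le_half, l1_nonneg x]

theorem eq_zero_of_eq_zero (h : Represents k P R e x 0) : x = 0 := by
  have hhalf := h.l1_sub_le_half
  rw [sub_zero] at hhalf
  exact l1_eq_zero_iff.1 (le_antisymm (by linarith) (l1_nonneg x))

theorem l1_sub_le {xh : Fin n → ℝ} {δ : ℝ} (h : Represents k P R 0 x x')
    (hδ : 4 * (n * δ) ≤ 2 ^ (-(P : ℤ)) * (2 ^ R)⁻¹)
    (hxh : ∀ j, |xh j - x' j| ≤ δ ∧ (x' j = 0 → xh j = 0)) :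
    l1 (x - xh) ≤ 2 ^ (-(P : ℤ)) * l1 x := by
  by_cases hzero : x' = 0
  · subst hzero
    rw [h.eq_zero_of_eq_zero, show xh = 0 from funext fun j => (hxh j).2 rfl]
    simp [l1]
  obtain ⟨j, hj⟩ := Function.ne_iff.1 hzero
  have hlow : (2 ^ R)⁻¹ ≤ 2 * l1 x :=
    ((h.inv_two_pow_le_abs_apply hj).trans (abs_le_l1 x' j)).trans h.l1_le_two_mul
  have hround : l1 (x' - xh) ≤ n * δ := l1_le_mul fun j => by
    rw [Pi.sub_apply, abs_sub_comm]
    exact (hxh j).1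
  have hacc := h.2.1
  rw [two_zpow_neg_succ] at hacc
  linarith [SHOFA.l1_sub_le x x' xh,
    mul_le_mul_of_nonneg_left hlow (zpow_nonneg two_pos.le (-(P : ℤ)) : (0 : ℝ) ≤ _)]

end Represents

theorem smul_measure (ω : Design n M d B) (x : Fin n → ℝ) (e : ℤ) :
    (2 : ℂ) ^ e • measure ω x = measure ω ((2 : ℝ) ^ e • x) := by
  rw [measure, measure, ← Matrix.mulVec_smul]
  congr 1
  funext j
  simp

theorem le_two_pow_precision (n P : ℕ) : n ≤ 2 ^ (Nat.clog 2 n + P) :=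
  (Nat.le_pow_clog one_lt_two n).trans (Nat.pow_le_pow_right two_pos (Nat.le_add_right _ _))

theorem four_mul_errBound_le {p P κ : ℕ} {ar : Arith} {ε X : ℝ}
    (h : Regime ar n k B ε X (2 ^ (κ * p))⁻¹) (htol : ar.tol ≤ 2 ^ (-(P : ℤ))) :
    4 * (n * errBound k ε X) ≤ 2 ^ (-(P : ℤ)) * (2 ^ (κ * p))⁻¹ := by
  have hnonneg : 0 ≤ n * errBound k ε X := mul_nonneg n.cast_nonneg h.errBound_nonneg
  linarith [h.err_le, mul_le_mul_of_nonneg_right htol h.eta_pos.le]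

theorem le_prob_decode_fixedPoint {c : ℕ} (hd : 3 ≤ d) (hc : 6 * d ^ 2 ≤ c) (hn : 2 ≤ n)
    (hk : 1 ≤ k) (hkn : k ≤ n) {pick : ℕ → Finset (Fin (c * k)) → Fin (c * k)}
    (hpick : ∀ t L, L.Nonempty → pick t L ∈ L) (κ P : ℕ) {x x' : Fin n → ℝ} {e : ℤ}
    (hx : Represents k P (κ * (Nat.clog 2 n + P)) e x x') :
    1 - (2 + 2 * c : ℝ) / k ≤ prob {ω : Design n (c * k) d (3 * Nat.clog 2 k) |
      l1 (x - (2 : ℝ) ^ e • (decode (fixedPoint ((2 * κ + 27) * (Nat.clog 2 n + P))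
        ((κ + 7) * (Nat.clog 2 n + P))) ω pick k ((2 : ℂ) ^ (-e) • measure ω x')).val)
        ≤ (2 : ℝ) ^ (-(P : ℤ)) * l1 x} := by
  have hregime := regime_fixedPoint hn hkn (le_two_pow_precision n P) κ
  have hscaled := hx.smul_zpow_neg
  set ar := fixedPoint ((2 * κ + 27) * (Nat.clog 2 n + P)) ((κ + 7) * (Nat.clog 2 n + P))
  have htol : ar.tol ≤ 2 ^ (-(P : ℤ)) := zpow_le_zpow_right₀ one_le_two (neg_le_neg (by
    exact_mod_cast (Nat.le_add_left P _).trans (Nat.le_mul_of_pos_left _ (by omega))))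
  have hδ := four_mul_errBound_le hregime htol
  refine (le_prob_recovers hd hc hk hregime hscaled.1 (fun _ => hscaled.inv_two_pow_le_abs_apply)
    (fun j => (hscaled.abs_apply_le j).trans_eq (zpow_zero 2)) hpick).trans
    (prob_mono fun ω hω => ?_)
  have herr := hscaled.l1_sub_le hδ hω
  rw [Set.mem_ofPred_eq, smul_measure]
  set xh := (decode ar ω pick k (measure ω ((2 : ℝ) ^ (-e) • x'))).val
  have hcancel : (2 : ℝ) ^ e • (2 : ℝ) ^ (-e) • x = x := by
    rw [smul_smul, ← zpow_add₀ two_ne_zero, add_neg_cancel, zpow_zero, one_smul]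
  calc l1 (x - (2 : ℝ) ^ e • xh)
    _ = |2 ^ e| * l1 ((2 : ℝ) ^ (-e) • x - xh) := by rw [← l1_smul, smul_sub, hcancel]
    _ ≤ |2 ^ e| * (2 ^ (-(P : ℤ)) * l1 ((2 : ℝ) ^ (-e) • x)) := by gcongr
    _ = 2 ^ (-(P : ℤ)) * l1 x := by rw [mul_left_comm, ← l1_smul, hcancel]

section Truncation

variable {x : Fin n → ℝ}

theorem exists_forall_abs_le_zpow (hx : x ≠ 0) :
    ∃ e : ℤ, (∀ j, |x j| ≤ 2 ^ e) ∧ 2 ^ (e - 1) ≤ l1 x := by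
  obtain ⟨e, hlt, hle⟩ := exists_mem_Ioc_zpow (norm_pos_iff.2 hx) (one_lt_two (α := ℝ))
  refine ⟨e + 1, fun j => (norm_le_pi_norm x j).trans hle, ?_⟩
  rw [add_sub_cancel_right]
  exact hlt.le.trans ((pi_norm_le_iff_of_nonneg (l1_nonneg x)).2 (abs_le_l1 x))

theorem l1_sub_indicator_le {b : ℝ} (hb : 0 ≤ b) :
    l1 (x - {j | b ≤ |x j|}.indicator x) ≤ n * b := l1_le_mul fun j => by
  by_cases hj : b ≤ |x j|
  · simp [hj, hb]
  · simpa [hj] using (not_le.1 hj).le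

theorem exists_represents {κ : ℕ} (hn : 2 ≤ n) (hκ : 3 ≤ κ) (P : ℕ) (hx : Sparse k x) :
    ∃ (x' : Fin n → ℝ) (e : ℤ), Represents k P (κ * (Nat.clog 2 n + P)) e x x' := by
  by_cases hzero : x = 0
  · exact ⟨0, 0, hx.mono fun j hj => absurd rfl hj, by simp [hzero, l1], fun j hj => absurd rfl hj⟩
  obtain ⟨e, hmax, hl1⟩ := exists_forall_abs_le_zpow hzero
  set R := κ * (Nat.clog 2 n + P)
  set S := {j | (2 : ℝ) ^ (e - R) ≤ |x j|}
  refine ⟨S.indicator x, e, hx.mono fun j hj => ?_, ?_, fun j hj => ?_⟩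
  · rwa [Set.indicator_of_mem (Set.mem_of_indicator_ne_zero hj)] at hj
  · calc l1 (x - S.indicator x)
      _ ≤ n * 2 ^ (e - R) := l1_sub_indicator_le (by positivity)
      _ ≤ 2 ^ (Nat.clog 2 n : ℤ) * 2 ^ (e - R) := by
          gcongr
          exact_mod_cast Nat.le_pow_clog one_lt_two n
      _ = 2 ^ (Nat.clog 2 n + (e - R)) := (zpow_add₀ two_ne_zero _ _).symm
      _ ≤ 2 ^ (-((P : ℤ) + 1) + (e - 1)) := by
          have hclog : 1 ≤ Nat.clog 2 n := Nat.clog_pos one_lt_two hn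
          have hR : 3 * (Nat.clog 2 n + P) ≤ R := Nat.mul_le_mul_right _ hκ
          exact zpow_le_zpow_right₀ one_le_two (by omega)
      _ = 2 ^ (-((P : ℤ) + 1)) * 2 ^ (e - 1) := zpow_add₀ two_ne_zero _ _
      _ ≤ 2 ^ (-((P : ℤ) + 1)) * l1 x := by gcongr
  · have hmem : j ∈ S := Set.mem_of_indicator_ne_zero hj
    rw [Set.indicator_of_mem hmem]
    exact ⟨hmem, hmax j⟩

end Truncation

end SHOFA

theorem theorem1_general (d : ℕ) (hd : 3 ≤ d) :
    ∃ c : ℕ, 0 < c ∧ ∀ κ : ℕ, ∃ (K T : ℕ) (C : ℝ), 0 < C ∧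
      ∀ n k P : ℕ, 2 ≤ n → 1 ≤ k → k ≤ n →
      ∀ pick : ℕ → Finset (Fin (c * k)) → Fin (c * k),
        (∀ t L, L.Nonempty → pick t L ∈ L) →
        (∀ x : Fin n → ℝ, SHOFA.Sparse k x →
          1 - C / k ≤ SHOFA.prob {ω : SHOFA.Design n (c * k) d (3 * Nat.clog 2 k) |
            (SHOFA.decode SHOFA.exact ω pick k (SHOFA.measure ω x)).val = x}) ∧
        (∀ (x x' : Fin n → ℝ) (e : ℤ),
          SHOFA.Represents k P (κ * (Nat.clog 2 n + P)) e x x' →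
          1 - C / k ≤ SHOFA.prob {ω : SHOFA.Design n (c * k) d (3 * Nat.clog 2 k) |
            SHOFA.l1 (x - (2 : ℝ) ^ e •
              (SHOFA.decode
                (SHOFA.fixedPoint (K * (Nat.clog 2 n + P)) (T * (Nat.clog 2 n + P)))
                ω pick k ((2 : ℂ) ^ (-e) • SHOFA.measure ω x')).val)
              ≤ (2 : ℝ) ^ (-(P : ℤ)) * SHOFA.l1 x}) ∧
        (3 ≤ κ → ∀ x : Fin n → ℝ, SHOFA.Sparse k x →
          ∃ (x' : Fin n → ℝ) (e : ℤ),
            SHOFA.Represents k P (κ * (Nat.clog 2 n + P)) e x x') ∧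
        (∀ (ω : SHOFA.Design n (c * k) d (3 * Nat.clog 2 k)) (y : Fin (c * k) × Fin 2 → ℂ),
          ((SHOFA.decode SHOFA.exact ω pick k y).steps : ℝ) ≤ C * k ∧
          ((SHOFA.decode
            (SHOFA.fixedPoint (K * (Nat.clog 2 n + P)) (T * (Nat.clog 2 n + P)))
            ω pick k y).steps : ℝ) ≤ C * k ∧
          ((SHOFA.decode
            (SHOFA.fixedPoint (K * (Nat.clog 2 n + P)) (T * (Nat.clog 2 n + P)))
            ω pick k y).steps : ℝ) *
              SHOFA.wordBits (K * (Nat.clog 2 n + P)) n (c * k)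
            ≤ C * (k * (Real.logb 2 n + P))) := by
  refine ⟨6 * d ^ 2, by positivity, fun κ => ?_⟩
  generalize hc : 6 * d ^ 2 = c
  obtain ⟨C, hfail, hsteps, hbits⟩ : ∃ C : ℝ, 2 + 2 * c ≤ C ∧ 31 * c + 35 + 37 * d ≤ C ∧
      (31 * c + 35 + 37 * d) * (8 * (2 * κ + 27 : ℕ) + 8 + c) ≤ C :=
    ⟨max _ (max _ _), le_max_left _ _, le_max_of_le_right (le_max_left _ _),
      le_max_of_le_right (le_max_right _ _)⟩
  refine ⟨2 * κ + 27, κ + 7, C, lt_of_lt_of_le (by positivity) hfail, ?_⟩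
  intro n k P hn hk hkn pick hpick
  have hprob : 1 - C / k ≤ 1 - (2 + 2 * c : ℝ) / k := by gcongr
  have hlogb : 0 ≤ Real.logb 2 n + P :=
    add_nonneg (zero_le_one.trans (SHOFA.one_le_logb_natCast hn)) P.cast_nonneg
  have hcost (ar) (ω : SHOFA.Design n (c * k) d (3 * Nat.clog 2 k)) (y) :=
    (SHOFA.steps_decode_le_mul ar ω pick y).trans
      (mul_le_mul_of_nonneg_right hsteps k.cast_nonneg)
  exact ⟨fun x hx => hprob.trans (SHOFA.le_prob_decode_exact hd hc.le hn hk hpick hx),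
    fun x x' e hx' => hprob.trans
      (SHOFA.le_prob_decode_fixedPoint hd hc.le hn hk hkn hpick κ P hx'),
    fun hκ x hx => SHOFA.exists_represents hn hκ P hx,
    fun ω y => ⟨hcost _ ω y, hcost _ ω y,
      (SHOFA.steps_decode_mul_wordBits_le hn hkn _ _ ω pick y).trans (by gcongr)⟩⟩

theorem theorem1 (d : ℕ) (hd : 7 ≤ d) :
    ∃ c : ℕ, 0 < c ∧ ∀ κ : ℕ, ∃ (K T : ℕ) (C : ℝ), 0 < C ∧
      ∀ n k P : ℕ, 2 ≤ n → 1 ≤ k → k ≤ n →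
      ∀ pick : ℕ → Finset (Fin (c * k)) → Fin (c * k),
        (∀ t L, L.Nonempty → pick t L ∈ L) →
        -- exact arithmetic
        (∀ x : Fin n → ℝ, SHOFA.Sparse k x →
          1 - C / k ≤ SHOFA.prob {ω : SHOFA.Design n (c * k) d (3 * Nat.clog 2 k) |
            (SHOFA.decode SHOFA.exact ω pick k (SHOFA.measure ω x)).val = x}) ∧
        -- finite precision
        (∀ (x x' : Fin n → ℝ) (e : ℤ), SHOFA.Sparse k x →
          SHOFA.Represents k P (κ * (Nat.clog 2 n + P)) e x x' →
          1 - C / k ≤ SHOFA.prob {ω : SHOFA.Design n (c * k) d (3 * Nat.clog 2 k) |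
            SHOFA.l1 (x - (2 : ℝ) ^ e •
              (SHOFA.decode
                (SHOFA.fixedPoint (K * (Nat.clog 2 n + P)) (T * (Nat.clog 2 n + P)))
                ω pick k ((2 : ℂ) ^ (-e) • SHOFA.measure ω x')).val)
              ≤ (2 : ℝ) ^ (-(P : ℤ)) * SHOFA.l1 x}) ∧
        -- every signal has a finite-precision representation
        (3 ≤ κ → ∀ x : Fin n → ℝ, SHOFA.Sparse k x →
          ∃ (x' : Fin n → ℝ) (e : ℤ),
            SHOFA.Represents k P (κ * (Nat.clog 2 n + P)) e x x') ∧
        -- numbers of steps and of bit operations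
        (∀ (ω : SHOFA.Design n (c * k) d (3 * Nat.clog 2 k)) (y : Fin (c * k) × Fin 2 → ℂ),
          ((SHOFA.decode SHOFA.exact ω pick k y).steps : ℝ) ≤ C * k ∧
          ((SHOFA.decode
            (SHOFA.fixedPoint (K * (Nat.clog 2 n + P)) (T * (Nat.clog 2 n + P)))
            ω pick k y).steps : ℝ) ≤ C * k ∧
          ((SHOFA.decode
            (SHOFA.fixedPoint (K * (Nat.clog 2 n + P)) (T * (Nat.clog 2 n + P)))
            ω pick k y).steps : ℝ) *
              SHOFA.wordBits (K * (Nat.clog 2 n + P)) n (c * k)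
            ≤ C * (k * (Real.logb 2 n + P))) := by
  obtain ⟨c, hc, h⟩ := theorem1_general d (by omega)
  exact ⟨c, hc, fun κ => (h κ).imp fun K ⟨T, C, hC, h⟩ => ⟨T, C, hC,
    fun n k P hn hk hkn pick hpick => (h n k P hn hk hkn pick hpick).imp_right
      (And.imp_left fun hfixed x x' e _ => hfixed x x' e)⟩⟩
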